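/- Let $d$ be countable (finite or $d=\infty$) and let $\underline C=(C_i)_{i}$ be a row contraction on a complex Hilbert space $\mathcal H_C$, i.e. a $d$-tuple of bounded operators with $\sum_i C_iC_i^*\le \mathbf 1$. **Notation.** For a row contraction $\underline T$ on $\mathcal H$, regarded as an operator $\bigoplus_i\mathcal H\to\mathcal H$, put $D_T=(\mathbf 1-\underline T^*\underline T)^{1/2}$ on $\bigoplus_i\mathcal H$, $D_{*,T}=(\mathbf 1-\underline T\,\underline T^*)^{1/2}$ on $\mathcal H$, $\mathcal D_T=\overline{\operatorname{range} D_T}$, $\mathcal D_{*,T}=\overline{\operatorname{range}D_{*,T}}$. Let $\Gamma$ be the full Fock space over $\mathbb C^d$, with orthonormal basis $e_\alpha$ indexed by the finite words $\alpha$ in the index set ($e_0$ the vacuum vector, belonging to the empty word) and creation operators $L_i$; write $T_\alpha=T_{\alpha_1}\cdots T_{\alpha_n}$. The minimal isometric dilation of $\underline T$ is realized on $\hat{\mathcal H}_T=\mathcal H\oplus(\Gamma\otimes\mathcal D_T)$ by $V^T_i(h\oplus f)=T_ih\oplus\big(e_0\otimes D_T(0,\dots,h,\dots,0)+(L_i\otimes\mathbf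 1)f\big)$, with $h$ in the $i$-th place. A contractive lifting of $\underline C$ by $\underline A$ is a row contraction $\underline E$ on $\mathcal H_E=\mathcal H_C\oplus\mathcal H_A$ with $E_i=\begin{pmatrix}C_i&0\\B_i&A_i\end{pmatrix}$ for all $i$. Let $\mathcal K$ be the orthogonal complement of $\overline{\operatorname{span}}\{V^E_\alpha\mathcal H_C\}$ in $\hat{\mathcal H}_E$ and $Y_i=V^E_i|_{\mathcal K}$. There is a unique unitary $$W:\mathcal H_E\oplus(\Gamma\otimes\mathcal D_E)\to\mathcal H_C\oplus(\Gamma\otimes\mathcal D_C)\oplus\mathcal K$$ which is the identity on $\mathcal H_C$ and on $\mathcal K$ and satisfies $WV^E_i=(V^C_i\oplus Y_i)W$ for all $i$. Let $\gamma:\mathcal D_{*,A}\to\mathcal D_C$ be the contraction determined by $\gamma D_{*,A}h=P_{e_0\otimes\mathcal D_C}Wh$ for $h\in\mathcal H_A$. The lifting is called *reduced* if * $\underline A$ is completely non-coisometric: $h=0$ is the only $h\in\mathcal H_A$ with $\sum_{|\alpha|=n}\|A_\alpha^*h\|^2=\|h\|^2$ for all $n$; and * $\gamma$ is resolving: for every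 $h\in\mathcal H_A$, if $\gamma D_{*,A}A_\alpha^*h=0$ for all words $\alpha$, then $D_{*,A}A_\alpha^*h=0$ for all words $\alpha$. The characteristic function of $\underline E$ is $M_{C,E}=P_{\Gamma\otimes\mathcal D_C}W|_{\Gamma\otimes\mathcal D_E}:\Gamma\otimes\mathcal D_E\to\Gamma\otimes\mathcal D_C$, with symbol $\Theta_{C,E}=M_{C,E}|_{e_0\otimes\mathcal D_E}$. **Theorem 4.3.7.** Let $\underline E$ on $\mathcal H_C\oplus\mathcal H_A$ and $\underline E'$ on $\mathcal H_C\oplus\mathcal H_{A'}$ be reduced liftings of $\underline C$. Then $\underline E$ and $\underline E'$ are unitarily equivalent, i.e. there is a unitary $u:\mathcal H_E\to\mathcal H_{E'}$ with $u|_{\mathcal H_C}=\mathbf 1$ and $E'_iu=uE_i$ for all $i$, if and only if their characteristic functions are equivalent, i.e. there is a unitary $v:\mathcal D_E\to\mathcal D_{E'}$ with $\Theta_{C,E}=\Theta_{C,E'}v$. Moreover every reduced lifting $\underline E$ of $\underline C$ has the following functional model, built from $\underline C$ and $M=M_{C,E}$ only. Put $\Delta=(\mathbf 1-M^*M)^{1/2}$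 on $\Gamma\otimes\mathcal D_E$. There are a unitary $\tau:\mathcal K\to\overline{\Delta(\Gamma\otimes\mathcal D_E)}$ with $\tau P_{\mathcal K}Wx=\Delta x$ for all $x\in\Gamma\otimes\mathcal D_E$, and bounded operators $Y^\Delta_i$ on $\overline{\Delta(\Gamma\otimes\mathcal D_E)}$ with $Y^\Delta_i\Delta x=\Delta(L_i\otimes\mathbf 1)x$ and $\tau Y_i=Y^\Delta_i\tau$, such that $$(\mathbf 1\oplus\tau)W\mathcal H_A=\big[(\Gamma\otimes\mathcal D_C)\oplus\overline{\Delta(\Gamma\otimes\mathcal D_E)}\big]\ominus\{Mx\oplus\Delta x:\ x\in\Gamma\otimes\mathcal D_E\},$$ and $(\mathbf 1\oplus\tau)WE_i^*h=(V^C_i\oplus Y^\Delta_i)^*(\mathbf 1\oplus\tau)Wh$ for all $h\in\mathcal H_E$ and all $i$. -/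

import Mathlib

open scoped InnerProductSpace
open ContinuousLinearMap (adjoint)

set_option synthInstance.maxHeartbeats 200000

noncomputable section

/-! ### Hilbert space sums -/

/-- The Hilbert space `⨁_{i ∈ ι} H` of square summable families in `H`. -/
abbrev L2 (ι : Type*) (H : Type*) [NormedAddCommGroup H] : Type _ :=
  lp (fun _ : ι => H) 2

/-- The Hilbert space direct sum `H ⊕ K`. -/
abbrev HSum (H K : Type*) : Type _ := WithLp 2 (H × K)

/-- `Γ ⊗ 𝒟`, where `Γ` is the full Fock space with orthonormal basis `e_α`, indexed by the words
`α` in the alphabet `ι`: the element `∑ e_α ⊗ d_α` is the square summable family `(d_α)`. -/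
abbrev Fock (ι : Type*) (D : Type*) [NormedAddCommGroup D] : Type _ := L2 (List ι) D

section HilbertSums

variable {ι : Type*} {H K : Type*} [NormedAddCommGroup H] [InnerProductSpace ℂ H]
  [NormedAddCommGroup K] [InnerProductSpace ℂ K]

/-- The embedding `h ↦ h ⊕ 0`. -/
def HSum.inl : H →ₗᵢ[ℂ] HSum H K where
  toFun h := WithLp.toLp 2 (h, 0)
  map_add' x y := by simp [← WithLp.toLp_add]
  map_smul' c x := by simp [← WithLp.toLp_smul]
  norm_map' x := by simp

/-- The embedding `k ↦ 0 ⊕ k`. -/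
def HSum.inr : K →ₗᵢ[ℂ] HSum H K where
  toFun k := WithLp.toLp 2 (0, k)
  map_add' x y := by simp [← WithLp.toLp_add]
  map_smul' c x := by simp [← WithLp.toLp_smul]
  norm_map' x := by simp

@[simp] theorem HSum.inl_fst (h : H) : (HSum.inl h : HSum H K).fst = h := rfl
@[simp] theorem HSum.inl_snd (h : H) : (HSum.inl h : HSum H K).snd = 0 := rfl
@[simp] theorem HSum.inr_fst (k : K) : (HSum.inr k : HSum H K).fst = 0 := rfl
@[simp] theorem HSum.inr_snd (k : K) : (HSum.inr k : HSum H K).snd = k := rfl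

/-- A family of operators with `∑ ‖f_i h‖² ≤ ‖h‖²`, as a column operator `h ↦ (f_i h)_i`. -/
def column (f : ι → H →L[ℂ] K) (hf : ∀ (s : Finset ι) (h : H), ∑ i ∈ s, ‖f i h‖ ^ 2 ≤ ‖h‖ ^ 2) :
    H →L[ℂ] L2 ι K :=
  LinearMap.mkContinuous
    { toFun := fun h => ⟨fun i => f i h, memℓp_gen' (C := ‖h‖ ^ 2) fun s => by
        simpa using hf s h⟩
      map_add' := fun x y => Subtype.ext (funext fun i => (f i).map_add x y)
      map_smul' := fun c x => Subtype.ext (funext fun i => (f i).map_smul c x) }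
    1 (fun h => by
      refine lp.norm_le_of_forall_sum_le (by norm_num) (by positivity) fun s => ?_
      simpa using hf s h)

@[simp] theorem column_apply (f : ι → H →L[ℂ] K) (hf) (h : H) (i : ι) :
    column f hf h i = f i h := rfl

theorem L2.hasSum_norm_sq {ι K : Type*} [NormedAddCommGroup K] (f : L2 ι K) : HasSum (fun i => ‖f i‖ ^ 2) (‖f‖ ^ 2) := by
  simpa using lp.hasSum_norm (p := 2) (by norm_num) f

open Classical in
/-- The embedding of `K` as the `i`-th summand; for `Fock ι 𝒟` it is `d ↦ e_α ⊗ d`. -/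
def L2.single (i : ι) : K →ₗᵢ[ℂ] L2 ι K where
  toFun k := lp.single 2 i k
  map_add' x y := lp.single_add _ _ _ _
  map_smul' c x := lp.single_smul _ _ _ _
  norm_map' x := lp.norm_single (by norm_num) _ _

theorem L2.single_eq [d : DecidableEq ι] (i : ι) (k : K) :
    L2.single i k = lp.single (E := fun _ : ι => K) 2 i k := by
  cases Subsingleton.elim d (Classical.decEq ι)
  simp only [L2.single]
  rfl

/-- The coordinate projection `⨁_{i ∈ ι} K → K`. -/
def L2.proj (i : ι) : L2 ι K →L[ℂ] K := lp.evalCLM ℂ (fun _ : ι => K) 2 i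

@[simp] theorem L2.proj_apply (i : ι) (f : L2 ι K) : L2.proj i f = f i := rfl

/-- The vacuum embedding `d ↦ e_0 ⊗ d`. -/
def Fock.vac : K →ₗᵢ[ℂ] Fock ι K := L2.single []

open Classical in
/-- The values of `(L_i ⊗ 1) f`. -/
def Fock.shiftFun (i : ι) (f : List ι → K) : List ι → K
  | [] => 0
  | j :: α => if j = i then f α else 0

theorem Fock.hasSum_shiftFun {ι K : Type*} [NormedAddCommGroup K] (i : ι) (f : Fock ι K) :
    HasSum (fun β => ‖Fock.shiftFun i f β‖ ^ 2) (‖f‖ ^ 2) := by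
  classical
  have hinj : Function.Injective (fun α : List ι => i :: α) := fun a b h => by simpa using h
  rw [← hinj.hasSum_iff]
  · simpa [Fock.shiftFun, Function.comp_def] using L2.hasSum_norm_sq f
  · rintro (_ | ⟨j, α⟩) hβ
    · simp [Fock.shiftFun]
    · have : j ≠ i := by rintro rfl; exact hβ ⟨α, rfl⟩
      simp [Fock.shiftFun, this]

/-- The creation operator `L_i ⊗ 1` on `Γ ⊗ K`, determined by `e_α ⊗ k ↦ e_{iα} ⊗ k`. -/
def Fock.shift (i : ι) : Fock ι K →ₗᵢ[ℂ] Fock ι K where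
  toFun f := ⟨Fock.shiftFun i f, memℓp_gen (by simpa using (Fock.hasSum_shiftFun i f).summable)⟩
  map_add' x y := by
    refine Subtype.ext (funext fun β => ?_)
    rcases β with _ | ⟨j, β⟩
    · exact (add_zero (0 : K)).symm
    · change Fock.shiftFun i _ (j :: β) = Fock.shiftFun i x (j :: β) + Fock.shiftFun i y (j :: β)
      by_cases h : j = i <;> simp [Fock.shiftFun, h]
  map_smul' c x := by
    refine Subtype.ext (funext fun β => ?_)
    rcases β with _ | ⟨j, β⟩
    · exact (smul_zero c).symm
    · by_cases h : j = i <;> simp [Fock.shiftFun, h]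
  norm_map' f := by
    have h := L2.hasSum_norm_sq
      (⟨Fock.shiftFun i f, memℓp_gen (by simpa using (Fock.hasSum_shiftFun i f).summable)⟩ :
        Fock ι K)
    exact (sq_eq_sq₀ (norm_nonneg _) (norm_nonneg _)).1 (h.unique (Fock.hasSum_shiftFun i f))

theorem L2.inner_single_left (i : ι) (a : K) (f : L2 ι K) : ⟪L2.single i a, f⟫_ℂ = ⟪a, f i⟫_ℂ := by
  classical exact lp.inner_single_left (𝕜 := ℂ) i a f

theorem L2.ext_single {f g : L2 ι K →L[ℂ] H} (h : ∀ i a, f (L2.single i a) = g (L2.single i a)) :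
    f = g := by
  classical
  refine lp.ext_continuousLinearMap (by norm_num) fun i => ContinuousLinearMap.ext fun a => ?_
  have := h i a
  simp only [L2.single] at this
  convert! this

/-- The diagonal extension `(h_i) ↦ (g h_i)` of an isometry. -/
def L2.map (g : H →ₗᵢ[ℂ] K) : L2 ι H →ₗᵢ[ℂ] L2 ι K where
  toFun f := ⟨fun i => g (f i), memℓp_gen (by simpa using (L2.hasSum_norm_sq f).summable)⟩
  map_add' x y := Subtype.ext (funext fun i => g.map_add (x i) (y i))
  map_smul' c x := Subtype.ext (funext fun i => g.map_smul c (x i))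
  norm_map' f := by
    have h := L2.hasSum_norm_sq (⟨fun i => g (f i),
      memℓp_gen (by simpa using (L2.hasSum_norm_sq f).summable)⟩ : L2 ι K)
    refine (sq_eq_sq₀ (norm_nonneg _) (norm_nonneg _)).1 (h.unique ?_)
    simpa using L2.hasSum_norm_sq f

theorem L2.map_apply (g : H →ₗᵢ[ℂ] K) (f : L2 ι H) (i : ι) : L2.map g f i = g (f i) := rfl

theorem L2.map_single (g : H →ₗᵢ[ℂ] K) (i : ι) (h : H) :
    L2.map g (L2.single i h : L2 ι H) = L2.single i (g h) := by
  classical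
  refine Subtype.ext (funext fun j => ?_)
  by_cases hj : j = i
  · subst hj; simp [L2.map_apply, L2.single]
  · simp [L2.map_apply, L2.single, hj]

theorem Fock.shift_single (i : ι) (α : List ι) (k : K) :
    Fock.shift i (L2.single α k : Fock ι K) = L2.single (i :: α) k := by
  classical
  refine Subtype.ext (funext fun β => ?_)
  rcases β with _ | ⟨j, β⟩
  · simp [Fock.shift, Fock.shiftFun, L2.single]
  · by_cases hj : j = i <;> simp [Fock.shift, Fock.shiftFun, L2.single, Pi.single_apply, hj]

theorem Fock.inner_vac_shift (k : K) (i : ι) (f : Fock ι K) :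
    ⟪Fock.vac k, Fock.shift i f⟫_ℂ = 0 := by
  rw [Fock.vac, L2.inner_single_left]
  exact inner_zero_right _

theorem Fock.inner_shift_shift {i j : ι} (hij : i ≠ j) (f g : Fock ι K) :
    ⟪Fock.shift i f, Fock.shift j g⟫_ℂ = 0 := by
  rw [lp.inner_eq_tsum]
  refine (tsum_congr fun β => ?_).trans tsum_zero
  rcases β with _ | ⟨k, β⟩
  · exact inner_zero_right _
  · by_cases hi : k = i
    · have hj : k ≠ j := hi ▸ hij
      simp [Fock.shift, Fock.shiftFun, hj]
    · simp [Fock.shift, Fock.shiftFun, hi]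

theorem HSum.inner_inl_left (h : H) (y : HSum H K) : ⟪HSum.inl h, y⟫_ℂ = ⟪h, y.fst⟫_ℂ := by
  simp [WithLp.prod_inner_apply, HSum.inl]

theorem HSum.inner_inr_left (k : K) (y : HSum H K) : ⟪HSum.inr k, y⟫_ℂ = ⟪k, y.snd⟫_ℂ := by
  simp [WithLp.prod_inner_apply, HSum.inr]

theorem HSum.inner_eq (x y : HSum H K) : ⟪x, y⟫_ℂ = ⟪x.fst, y.fst⟫_ℂ + ⟪x.snd, y.snd⟫_ℂ :=
  WithLp.prod_inner_apply _ _

end HilbertSums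

/-- The defect operator `(1 - T* T)^{1/2}` of a contraction `T : H → K`. -/
def sqrtCompl {H K : Type*} [NormedAddCommGroup H] [InnerProductSpace ℂ H] [CompleteSpace H]
    [NormedAddCommGroup K] [InnerProductSpace ℂ K] [CompleteSpace K] (T : H →L[ℂ] K) : H →L[ℂ] H :=
  CFC.sqrt (1 - adjoint T ∘L T)

theorem inner_sqrtCompl {H K : Type*} [NormedAddCommGroup H] [InnerProductSpace ℂ H]
    [CompleteSpace H] [NormedAddCommGroup K] [InnerProductSpace ℂ K] [CompleteSpace K]
    {T : H →L[ℂ] K} (hT : ∀ x, ‖T x‖ ≤ ‖x‖) (x y : H) :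
    ⟪sqrtCompl T x, sqrtCompl T y⟫_ℂ = ⟪x, y⟫_ℂ - ⟪T x, T y⟫_ℂ := by
  have hpos : 0 ≤ 1 - adjoint T ∘L T := by
    rw [sub_nonneg, ContinuousLinearMap.le_def, ContinuousLinearMap.isPositive_iff_complex]
    intro z
    have : ⟪(1 - adjoint T ∘L T) z, z⟫_ℂ = ((‖z‖ ^ 2 - ‖T z‖ ^ 2 : ℝ) : ℂ) := by
      rw [sub_apply, inner_sub_left, ContinuousLinearMap.comp_apply,
        ContinuousLinearMap.adjoint_inner_left, one_apply_eq_self, inner_self_eq_norm_sq_to_K,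
        inner_self_eq_norm_sq_to_K]
      simp
    rw [this]
    refine ⟨rfl, sub_nonneg.2 ?_⟩
    exact pow_le_pow_left₀ (norm_nonneg _) (hT z) 2
  have hsq : sqrtCompl T * sqrtCompl T = 1 - adjoint T ∘L T := CFC.sqrt_mul_sqrt_self _ hpos
  have hsa : adjoint (sqrtCompl T) = sqrtCompl T :=
    (IsSelfAdjoint.of_nonneg (CFC.sqrt_nonneg (1 - adjoint T ∘L T))).adjoint_eq
  rw [← ContinuousLinearMap.adjoint_inner_right, hsa]
  change ⟪x, (sqrtCompl T * sqrtCompl T) y⟫_ℂ = _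
  rw [hsq, sub_apply, inner_sub_right, ContinuousLinearMap.comp_apply,
    ContinuousLinearMap.adjoint_inner_right]
  rfl

theorem add_sum_le_norm_sq {ι M : Type*} [NormedAddCommGroup M] [InnerProductSpace ℂ M]
    (w x : M) (v : ι → M) (D : ℝ) (n : ι → ℝ) (s : Finset ι) (hww : ⟪w, w⟫_ℂ = D)
    (hwx : ⟪w, x⟫_ℂ = D) (hwv : ∀ i, ⟪w, v i⟫_ℂ = 0) (hvv : ∀ i, ⟪v i, v i⟫_ℂ = n i)
    (hvx : ∀ i, ⟪v i, x⟫_ℂ = n i) (hne : ∀ i j, i ≠ j → ⟪v i, v j⟫_ℂ = 0) :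
    D + ∑ i ∈ s, n i ≤ ‖x‖ ^ 2 := by
  set S : ℝ := ∑ i ∈ s, n i with hS
  set u := w + ∑ i ∈ s, v i with hu
  have h1 : ⟪∑ i ∈ s, v i, x⟫_ℂ = (S : ℂ) := by
    rw [sum_inner, hS, Complex.ofReal_sum]; exact Finset.sum_congr rfl fun i _ => hvx i
  have h2 : ⟪∑ i ∈ s, v i, ∑ i ∈ s, v i⟫_ℂ = (S : ℂ) := by
    rw [sum_inner, hS, Complex.ofReal_sum]
    refine Finset.sum_congr rfl fun i hi => ?_
    rw [inner_sum, Finset.sum_eq_single_of_mem i hi (fun j _ hj => hne i j hj.symm), hvv]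
  have h3 : ⟪w, ∑ i ∈ s, v i⟫_ℂ = 0 := by
    rw [inner_sum]; exact Finset.sum_eq_zero fun i _ => hwv i
  have h3' : ⟪∑ i ∈ s, v i, w⟫_ℂ = 0 := by rw [← inner_conj_symm, h3, map_zero]
  have h4 : ⟪u, x⟫_ℂ = ((D + S : ℝ) : ℂ) := by
    rw [hu, inner_add_left, hwx, h1]; simp
  have h5 : ⟪u, u⟫_ℂ = ((D + S : ℝ) : ℂ) := by
    rw [hu, inner_add_left, inner_add_right, inner_add_right, h3, h3', h2, hww]; simp
  have hun : ‖u‖ ^ 2 = D + S := by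
    rw [← inner_self_eq_norm_sq (𝕜 := ℂ) u, h5]; rfl
  have hle : D + S ≤ ‖u‖ * ‖x‖ := by
    have h6 := norm_inner_le_norm (𝕜 := ℂ) u x
    rw [h4, Complex.norm_real] at h6
    exact (le_abs_self _).trans h6
  have h7 : ‖u‖ ≤ ‖x‖ := by
    by_contra hlt
    push Not at hlt
    nlinarith [norm_nonneg x, norm_nonneg u]
  rw [← hun]
  exact pow_le_pow_left₀ (norm_nonneg _) h7 2

section ClosedRange

variable {H K : Type*} [NormedAddCommGroup H] [InnerProductSpace ℂ H] [NormedAddCommGroup K]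
  [InnerProductSpace ℂ K]

/-- The closure of the range of an operator, as a Hilbert space. -/
def ClosedRange (S : H →L[ℂ] K) : Type _ := (LinearMap.range S.toLinearMap).topologicalClosure

instance (S : H →L[ℂ] K) : NormedAddCommGroup (ClosedRange S) :=
  inferInstanceAs (NormedAddCommGroup (LinearMap.range S.toLinearMap).topologicalClosure)

instance (S : H →L[ℂ] K) : InnerProductSpace ℂ (ClosedRange S) :=
  inferInstanceAs (InnerProductSpace ℂ (LinearMap.range S.toLinearMap).topologicalClosure)

instance [CompleteSpace K] (S : H →L[ℂ] K) : CompleteSpace (ClosedRange S) :=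
  inferInstanceAs (CompleteSpace (LinearMap.range S.toLinearMap).topologicalClosure)

/-- The operator `S`, with values in the closure of its range. -/
def toClosedRange (S : H →L[ℂ] K) : H →L[ℂ] ClosedRange S :=
  S.codRestrict (LinearMap.range S.toLinearMap).topologicalClosure
    fun x => Submodule.le_topologicalClosure _ ⟨x, rfl⟩

theorem inner_toClosedRange (S : H →L[ℂ] K) (x y : H) :
    ⟪toClosedRange S x, toClosedRange S y⟫_ℂ = ⟪S x, S y⟫_ℂ := rfl

theorem denseRange_toClosedRange (S : H →L[ℂ] K) : DenseRange (toClosedRange S) := by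
  have h : Dense (Set.range fun x : H => (⟨S x, Submodule.le_topologicalClosure _ ⟨x, rfl⟩⟩ :
      (LinearMap.range S.toLinearMap).topologicalClosure)) := by
    refine Topology.IsInducing.subtypeVal.dense_iff.2 fun x => ?_
    rw [← Set.range_comp]
    exact x.2
  exact h

end ClosedRange

/-! ### Row contractions -/

/-- A row contraction: a tuple `(T_i)` of bounded operators with `∑ T_i T_i* ≤ 1`. -/
structure RowContraction (ι : Type*) (H : Type*) [NormedAddCommGroup H] [InnerProductSpace ℂ H]
    [CompleteSpace H] where
  /-- The operators `T_i`. -/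
  op : ι → H →L[ℂ] H
  contractive : ∀ s : Finset ι, ∑ i ∈ s, op i * adjoint (op i) ≤ 1

namespace RowContraction

variable {ι : Type*} {H : Type*} [NormedAddCommGroup H] [InnerProductSpace ℂ H] [CompleteSpace H]

theorem sum_mul_adjoint_le_one_iff {T : ι → H →L[ℂ] H} {s : Finset ι} :
    ∑ i ∈ s, T i * adjoint (T i) ≤ 1 ↔ ∀ h, ∑ i ∈ s, ‖adjoint (T i) h‖ ^ 2 ≤ ‖h‖ ^ 2 := by
  have key : ∀ h, ⟪(1 - ∑ i ∈ s, T i * adjoint (T i)) h, h⟫_ℂ =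
      ((‖h‖ ^ 2 - ∑ i ∈ s, ‖adjoint (T i) h‖ ^ 2 : ℝ) : ℂ) := fun h => by
    have : ∀ i, ⟪(T i * adjoint (T i)) h, h⟫_ℂ = ((‖adjoint (T i) h‖ ^ 2 : ℝ) : ℂ) := fun i => by
      change ⟪T i (adjoint (T i) h), h⟫_ℂ = _
      rw [← ContinuousLinearMap.adjoint_inner_right, inner_self_eq_norm_sq_to_K]
      simp
    simp only [sub_apply, one_apply_eq_self, inner_sub_left, sum_apply, sum_inner, this,
      inner_self_eq_norm_sq_to_K]
    simp
  rw [ContinuousLinearMap.le_def, ContinuousLinearMap.isPositive_iff_complex]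
  refine forall_congr' fun h => ?_
  rw [key]
  exact ⟨fun h => sub_nonneg.1 h.2, fun h => ⟨rfl, sub_nonneg.2 h⟩⟩

variable (T : RowContraction ι H)

theorem sum_norm_sq_le (s : Finset ι) (h : H) :
    ∑ i ∈ s, ‖adjoint (T.op i) h‖ ^ 2 ≤ ‖h‖ ^ 2 :=
  sum_mul_adjoint_le_one_iff.1 (T.contractive s) h

/-- The row operator `T = (T_1, T_2, …) : ⨁ H → H`, as the adjoint of the column operator
`h ↦ (T_i* h)_i`. -/
def row : L2 ι H →L[ℂ] H :=
  adjoint (column (fun i => adjoint (T.op i)) T.sum_norm_sq_le)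

theorem adjoint_row_apply (h : H) (i : ι) : adjoint T.row h i = adjoint (T.op i) h := by
  simp [row]

theorem row_single (i : ι) (h : H) : T.row (L2.single i h) = T.op i h := by
  refine ext_inner_right ℂ fun v => ?_
  rw [← ContinuousLinearMap.adjoint_inner_right, L2.inner_single_left, adjoint_row_apply,
    ContinuousLinearMap.adjoint_inner_right]

theorem norm_adjoint_row_le (h : H) : ‖adjoint T.row h‖ ≤ ‖h‖ := by
  refine lp.norm_le_of_forall_sum_le (by norm_num) (by positivity) fun s => ?_
  simpa [adjoint_row_apply] using T.sum_norm_sq_le s h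

theorem norm_row_le (x : L2 ι H) : ‖T.row x‖ ≤ ‖x‖ := by
  have h : ‖T.row‖ ≤ 1 := by
    rw [← (adjoint : (L2 ι H →L[ℂ] H) ≃ₗᵢ⋆[ℂ] _).norm_map T.row]
    exact ContinuousLinearMap.opNorm_le_bound _ zero_le_one fun h => by
      simpa using T.norm_adjoint_row_le h
  simpa using T.row.le_of_opNorm_le h x

/-- `D = (1 - T* T)^{1/2}` on `⨁ H`. -/
def defect : L2 ι H →L[ℂ] L2 ι H := sqrtCompl T.row

/-- `D_* = (1 - T T*)^{1/2}` on `H`. -/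
def defectStar : H →L[ℂ] H := sqrtCompl (adjoint T.row)

/-- `𝒟`, the closed range of `D`. -/
abbrev DefectSpace : Type _ := ClosedRange T.defect

/-- `𝒟_*`, the closed range of `D_*`. -/
abbrev DefectStarSpace : Type _ := ClosedRange T.defectStar

/-- `D`, as an operator into `𝒟`. -/
def defectTo : L2 ι H →L[ℂ] T.DefectSpace := toClosedRange T.defect

/-- `D_*`, as an operator into `𝒟_*`. -/
def defectStarTo : H →L[ℂ] T.DefectStarSpace := toClosedRange T.defectStar

theorem inner_defect (x y : L2 ι H) :
    ⟪T.defectTo x, T.defectTo y⟫_ℂ = ⟪x, y⟫_ℂ - ⟪T.row x, T.row y⟫_ℂ :=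
  inner_sqrtCompl T.norm_row_le x y

theorem norm_defectStar_sq (h : H) :
    ‖T.defectStarTo h‖ ^ 2 = ‖h‖ ^ 2 - ‖adjoint T.row h‖ ^ 2 := by
  have := congrArg Complex.re (inner_sqrtCompl T.norm_adjoint_row_le h h)
  simp only [inner_self_eq_norm_sq_to_K, Complex.sub_re] at this
  exact_mod_cast this

theorem denseRange_defectTo : DenseRange T.defectTo := denseRange_toClosedRange _

theorem denseRange_defectStarTo : DenseRange T.defectStarTo := denseRange_toClosedRange _

/-- The space `H ⊕ (Γ ⊗ 𝒟)` of the minimal isometric dilation. -/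
abbrev Mid : Type _ := HSum H (Fock ι T.DefectSpace)

/-- The minimal isometric dilation:
`V_i (h ⊕ f) = T_i h ⊕ (e_0 ⊗ D_i h + (L_i ⊗ 1) f)`, where `D_i h = D (0, …, h, …, 0)`. -/
def midOp (i : ι) : T.Mid →L[ℂ] T.Mid :=
  HSum.inl.toContinuousLinearMap ∘L T.op i ∘L WithLp.fstL 2 ℂ _ _ +
  HSum.inr.toContinuousLinearMap ∘L
    (Fock.vac.toContinuousLinearMap ∘L T.defectTo ∘L (L2.single i).toContinuousLinearMap ∘L
        WithLp.fstL 2 ℂ _ _ +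
      (Fock.shift i).toContinuousLinearMap ∘L WithLp.sndL 2 ℂ _ _)

theorem midOp_apply (i : ι) (x : T.Mid) :
    T.midOp i x = HSum.inl (T.op i x.fst) + HSum.inr
      (Fock.vac (T.defectTo (L2.single i x.fst)) + Fock.shift i x.snd) := rfl

theorem midOp_fst (i : ι) (x : T.Mid) : (T.midOp i x).fst = T.op i x.fst := by
  simp [midOp_apply]

theorem midOp_snd (i : ι) (x : T.Mid) :
    (T.midOp i x).snd = Fock.vac (T.defectTo (L2.single i x.fst)) + Fock.shift i x.snd := by
  simp [midOp_apply]

theorem inner_midOp_midOp (i j : ι) (x y : T.Mid) :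
    ⟪T.midOp i x, T.midOp j y⟫_ℂ =
      ⟪(L2.single i x.fst : L2 ι H), L2.single j y.fst⟫_ℂ + ⟪Fock.shift i x.snd, Fock.shift j y.snd⟫_ℂ := by
  have h : ⟪Fock.shift i x.snd, Fock.vac (T.defectTo (L2.single j y.fst))⟫_ℂ = 0 := by
    rw [← inner_conj_symm, Fock.inner_vac_shift, map_zero]
  rw [HSum.inner_eq, midOp_fst, midOp_fst, midOp_snd, midOp_snd, inner_add_left, inner_add_right,
    inner_add_right, Fock.inner_vac_shift, h, LinearIsometry.inner_map_map, inner_defect,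
    row_single, row_single]
  ring

theorem inner_midOp_self (i : ι) (x y : T.Mid) : ⟪T.midOp i x, T.midOp i y⟫_ℂ = ⟪x, y⟫_ℂ := by
  rw [inner_midOp_midOp, LinearIsometry.inner_map_map, LinearIsometry.inner_map_map, HSum.inner_eq]

theorem inner_midOp_of_ne {i j : ι} (hij : i ≠ j) (x y : T.Mid) :
    ⟪T.midOp i x, T.midOp j y⟫_ℂ = 0 := by
  classical
  rw [inner_midOp_midOp, Fock.inner_shift_shift hij, L2.inner_single_left, add_zero]
  simp [L2.single, hij]

theorem inner_midOp_inl (i : ι) (x : T.Mid) (h : H) :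
    ⟪T.midOp i x, HSum.inl h⟫_ℂ = ⟪x, HSum.inl (adjoint (T.op i) h)⟫_ℂ := by
  rw [HSum.inner_eq, HSum.inner_eq, midOp_fst]
  simp [ContinuousLinearMap.adjoint_inner_right]

/-- `V_α = V_{α_1} ⋯ V_{α_n}` for the tuple `V` of the minimal isometric dilation. -/
def midWord (α : List ι) : T.Mid →L[ℂ] T.Mid := (α.map T.midOp).prod

/-- `T_α = T_{α_1} ⋯ T_{α_n}`. -/
def word (α : List ι) : H →L[ℂ] H := (α.map T.op).prod

/-- Complete non-coisometricity: the only `h` with `∑_{|α| = n} ‖T_α* h‖² = ‖h‖²` for all `n`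
is `h = 0`. -/
def IsCompletelyNonCoisometric : Prop :=
  ∀ h : H, (∀ n : ℕ, HasSum (fun α : {α : List ι // α.length = n} => ‖adjoint (T.word α) h‖ ^ 2)
    (‖h‖ ^ 2)) → h = 0

end RowContraction

/-! ### Multi-analytic operators -/

section MultiAnalytic

variable {ι D D' K : Type*} [NormedAddCommGroup D] [InnerProductSpace ℂ D] [CompleteSpace D]
  [NormedAddCommGroup D'] [InnerProductSpace ℂ D'] [CompleteSpace D'] [NormedAddCommGroup K]
  [InnerProductSpace ℂ K] [CompleteSpace K]

/-- The symbol `Θ : 𝒟 → Γ ⊗ 𝒦`, `Θ d = M (e_0 ⊗ d)`. -/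
def symbol (M : Fock ι D →L[ℂ] Fock ι K) : D →L[ℂ] Fock ι K := M ∘L Fock.vac.toContinuousLinearMap

/-- Equivalence of multi-analytic operators: `Θ = Θ' v` for some unitary `v : 𝒟 → 𝒟'`. -/
def MultiAnalyticEquivalent (M : Fock ι D →L[ℂ] Fock ι K) (M' : Fock ι D' →L[ℂ] Fock ι K) : Prop :=
  ∃ v : D ≃ₗᵢ[ℂ] D', ∀ d, symbol M d = symbol M' (v d)

/-- The closed range of `Δ = (1 - M* M)^{1/2}`. -/
abbrev DeltaSpace (M : Fock ι D →L[ℂ] Fock ι K) : Type _ := ClosedRange (sqrtCompl M)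

/-- `Δ = (1 - M* M)^{1/2}`, as an operator into its closed range. -/
def delta (M : Fock ι D →L[ℂ] Fock ι K) : Fock ι D →L[ℂ] DeltaSpace M := toClosedRange (sqrtCompl M)

/-- The space `(Γ ⊗ 𝒦) ⊕ closure (range Δ)`. -/
abbrev ModelSpace (M : Fock ι D →L[ℂ] Fock ι K) : Type _ := HSum (Fock ι K) (DeltaSpace M)

/-- The subspace `[(Γ ⊗ 𝒦) ⊕ closure (range Δ)] ⊖ {M x ⊕ Δ x : x ∈ Γ ⊗ 𝒟}`. -/
def modelSubspace (M : Fock ι D →L[ℂ] Fock ι K) : Submodule ℂ (ModelSpace M) :=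
  (Submodule.span ℂ {y | ∃ x : Fock ι D, y.fst = M x ∧ y.snd = delta M x})ᗮ

end MultiAnalytic

/-! ### Contractive liftings -/

/-- A contractive lifting `E` of `C` on `H_C ⊕ H_A`: a row contraction with `P E_i = C_i P`, `P` the
projection onto `H_C`; in other words `E_i` has the block form `(C_i, 0; B_i, A_i)`. -/
structure ContractiveLifting {ι HC : Type*} [NormedAddCommGroup HC] [InnerProductSpace ℂ HC]
    [CompleteSpace HC] (C : RowContraction ι HC) (HA : Type*) [NormedAddCommGroup HA]
    [InnerProductSpace ℂ HA] [CompleteSpace HA] extends RowContraction ι (HSum HC HA) where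
  fst_op : ∀ i x, (op i x).fst = C.op i x.fst

namespace ContractiveLifting

variable {ι HC HA : Type*} [NormedAddCommGroup HC] [InnerProductSpace ℂ HC] [CompleteSpace HC]
  [NormedAddCommGroup HA] [InnerProductSpace ℂ HA] [CompleteSpace HA] {C : RowContraction ι HC}
  (E : ContractiveLifting C HA)

/-- The lower right corner `A_i : H_A → H_A` of `E_i`. -/
def cornerOp (i : ι) : HA →L[ℂ] HA :=
  WithLp.sndL 2 ℂ HC HA ∘L E.op i ∘L HSum.inr.toContinuousLinearMap

theorem op_inr (i : ι) (a : HA) : E.op i (HSum.inr a) = HSum.inr (E.cornerOp i a) := by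
  refine WithLp.ofLp_injective 2 (Prod.ext ?_ rfl)
  exact (E.fst_op i _).trans (map_zero _)

theorem adjoint_op_inl (i : ι) (h : HC) :
    adjoint (E.op i) (HSum.inl h) = HSum.inl (adjoint (C.op i) h) := by
  refine ext_inner_right ℂ fun v => ?_
  rw [ContinuousLinearMap.adjoint_inner_left, HSum.inner_eq, HSum.inner_eq, E.fst_op]
  simp [ContinuousLinearMap.adjoint_inner_left]

theorem adjoint_cornerOp (i : ι) (a : HA) :
    adjoint (E.cornerOp i) a = (adjoint (E.op i) (HSum.inr a)).snd := by
  refine ext_inner_right ℂ fun v => ?_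
  have h := ContinuousLinearMap.adjoint_inner_left (E.op i) (HSum.inr v) (HSum.inr a)
  rw [E.op_inr, HSum.inner_eq, HSum.inner_eq] at h
  rw [ContinuousLinearMap.adjoint_inner_left]
  simpa using h.symm

/-- The row contraction `A` by which `C` is lifted. -/
def corner : RowContraction ι HA where
  op := E.cornerOp
  contractive s := by
    refine RowContraction.sum_mul_adjoint_le_one_iff.2 fun a => ?_
    have h := E.sum_norm_sq_le s (HSum.inr a)
    rw [LinearIsometry.norm_map] at h
    refine (Finset.sum_le_sum fun i _ => ?_).trans h
    rw [adjoint_cornerOp]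
    exact pow_le_pow_left₀ (norm_nonneg _) (WithLp.norm_snd_le _ _) 2

/-- The subspace `𝒦`: the orthogonal complement, in the space of the minimal isometric dilation
`V^E`, of the space spanned by the `V^E_α H_C`, on which `V^E` restricts to the minimal isometric
dilation of `C`. -/
def residual : Submodule ℂ E.Mid :=
  (Submodule.span ℂ {y | ∃ (α : List ι) (h : HC), y = E.midWord α (HSum.inl (HSum.inl h))})ᗮ

/-- The Hilbert space `𝒦`. -/
def Residual : Type _ := E.residual

instance : NormedAddCommGroup E.Residual := inferInstanceAs (NormedAddCommGroup E.residual)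

instance : InnerProductSpace ℂ E.Residual := inferInstanceAs (InnerProductSpace ℂ E.residual)

instance : CompleteSpace E.Residual := by
  have h : CompleteSpace E.residual := by unfold residual; infer_instance
  exact h

/-- The inclusion of `𝒦`. -/
def residualIncl : E.Residual →ₗᵢ[ℂ] E.Mid := E.residual.subtypeₗᵢ

theorem residualIncl_mem (k : E.Residual) : E.residualIncl k ∈ E.residual := Subtype.property k

theorem mem_residual_iff {k : E.Mid} : k ∈ E.residual ↔
    ∀ (α : List ι) (h : HC), ⟪E.midWord α (HSum.inl (HSum.inl h)), k⟫_ℂ = 0 := by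
  refine ⟨fun hk α h => hk _ (Submodule.subset_span ⟨α, h, rfl⟩), fun hk y hy => ?_⟩
  induction hy using Submodule.span_induction with
  | mem y hy => obtain ⟨α, h, rfl⟩ := hy; exact hk α h
  | zero => exact inner_zero_left _
  | add x y _ _ hx hy => rw [inner_add_left, hx, hy, add_zero]
  | smul c x _ hx => rw [inner_smul_left, hx, mul_zero]

theorem midOp_mem_residual (i : ι) {k : E.Mid} (hk : k ∈ E.residual) :
    E.midOp i k ∈ E.residual := by
  rw [mem_residual_iff] at hk ⊢
  rintro (_ | ⟨j, α⟩) h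
  · change ⟪HSum.inl (HSum.inl h), E.midOp i k⟫_ℂ = 0
    rw [← inner_conj_symm, RowContraction.inner_midOp_inl, E.adjoint_op_inl, inner_conj_symm]
    exact hk [] _
  · change ⟪E.midOp j (E.midWord α _), E.midOp i k⟫_ℂ = 0
    by_cases hij : j = i
    · subst hij
      rw [RowContraction.inner_midOp_self]
      exact hk _ _
    · exact E.inner_midOp_of_ne hij _ _

/-- The restriction `Y_i` of `V_i^E` to `𝒦`. -/
def residualOp (i : ι) : E.Residual →L[ℂ] E.Residual :=
  (E.midOp i ∘L E.residualIncl.toContinuousLinearMap).codRestrict E.residual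
    fun k => E.midOp_mem_residual i (E.residualIncl_mem k)

theorem residualIncl_residualOp (i : ι) (k : E.Residual) :
    E.residualIncl (E.residualOp i k) = E.midOp i (E.residualIncl k) := rfl

/-- The map `x ↦ V^E x - C x` on `⨁ H_C`, where `V^E`, `C` stand for the row operators. -/
def preEmbed : L2 ι HC →L[ℂ] E.Mid :=
  HSum.inl.toContinuousLinearMap ∘L HSum.inr.toContinuousLinearMap ∘L WithLp.sndL 2 ℂ HC HA ∘L
      E.row ∘L (L2.map HSum.inl).toContinuousLinearMap +
    HSum.inr.toContinuousLinearMap ∘L Fock.vac.toContinuousLinearMap ∘L E.defectTo ∘L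
      (L2.map HSum.inl).toContinuousLinearMap

theorem preEmbed_fst (x : L2 ι HC) :
    (E.preEmbed x).fst = HSum.inr (E.row (L2.map HSum.inl x)).snd := by
  simp [preEmbed]

theorem preEmbed_snd (x : L2 ι HC) :
    (E.preEmbed x).snd = Fock.vac (E.defectTo (L2.map HSum.inl x)) := by
  simp [preEmbed]

theorem row_map_inl_fst (x : L2 ι HC) : (E.row (L2.map HSum.inl x)).fst = C.row x := by
  have h : WithLp.fstL 2 ℂ HC HA ∘L E.row ∘L (L2.map HSum.inl).toContinuousLinearMap = C.row := by
    refine L2.ext_single fun i h => ?_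
    simp [L2.map_single, RowContraction.row_single, E.fst_op]
  exact DFunLike.congr_fun h x

theorem inner_preEmbed (x y : L2 ι HC) :
    ⟪E.preEmbed x, E.preEmbed y⟫_ℂ = ⟪C.defectTo x, C.defectTo y⟫_ℂ := by
  rw [HSum.inner_eq, preEmbed_fst, preEmbed_snd, preEmbed_fst, preEmbed_snd,
    LinearIsometry.inner_map_map, LinearIsometry.inner_map_map, RowContraction.inner_defect,
    RowContraction.inner_defect, LinearIsometry.inner_map_map, HSum.inner_eq (E.row _),
    row_map_inl_fst, row_map_inl_fst]
  ring

theorem preEmbed_single (i : ι) (h : HC) : E.preEmbed (L2.single i h) =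
    E.midOp i (HSum.inl (HSum.inl h)) - HSum.inl (HSum.inl (C.op i h)) := by
  have h1 : (E.op i (HSum.inl h)).fst = C.op i h := E.fst_op _ _
  refine WithLp.ofLp_injective 2 (Prod.ext ?_ ?_)
  · change (E.preEmbed _).fst = (E.midOp i _ - HSum.inl _ : E.Mid).fst
    rw [preEmbed_fst, WithLp.sub_fst, RowContraction.midOp_fst, L2.map_single,
      RowContraction.row_single]
    refine WithLp.ofLp_injective 2 (Prod.ext ?_ ?_)
    · change (HSum.inr _ : HSum HC HA).fst = (E.op i (HSum.inl h) - HSum.inl _ : HSum HC HA).fst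
      rw [WithLp.sub_fst, h1]; simp
    · change (HSum.inr _ : HSum HC HA).snd = (E.op i (HSum.inl h) - HSum.inl _ : HSum HC HA).snd
      rw [WithLp.sub_snd]; simp
  · change (E.preEmbed _).snd = (E.midOp i _ - HSum.inl _ : E.Mid).snd
    rw [preEmbed_snd, WithLp.sub_snd, RowContraction.midOp_snd, L2.map_single]
    simp

theorem inner_preEmbed_midOp (x : L2 ι HC) (i : ι) (z : E.Mid) (hz : z.fst.fst = 0) :
    ⟪E.preEmbed x, E.midOp i z⟫_ℂ = 0 := by
  have h0 : (E.op i z.fst).fst = 0 := by rw [E.fst_op, hz, map_zero]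
  have h1 : ⟪E.row (L2.map HSum.inl x), E.op i z.fst⟫_ℂ =
      ⟪(E.row (L2.map HSum.inl x)).snd, (E.op i z.fst).snd⟫_ℂ := by
    rw [HSum.inner_eq, h0, inner_zero_right, zero_add]
  have h2 : ⟪L2.map HSum.inl x, L2.single i z.fst⟫_ℂ = 0 := by
    rw [← inner_conj_symm, L2.inner_single_left, L2.map_apply, HSum.inner_eq, hz]
    simp
  rw [HSum.inner_eq, preEmbed_fst, preEmbed_snd, RowContraction.midOp_fst,
    RowContraction.midOp_snd, inner_add_right, Fock.inner_vac_shift, LinearIsometry.inner_map_map,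
    RowContraction.inner_defect, RowContraction.row_single, h1, h2, HSum.inner_eq (HSum.inr _)]
  simp

/-- The isometry `𝒟_C → ℋ̂_E` with `D_C x ↦ V^E x - C x`. -/
def embedDefect : C.DefectSpace →ₗᵢ[ℂ] E.Mid where
  toLinearMap := (E.preEmbed.toLinearMap.extendOfNorm C.defectTo.toLinearMap).toLinearMap
  norm_map' d := by
    have hn : ∀ x, ‖E.preEmbed x‖ = ‖C.defectTo x‖ := fun x => by
      rw [@norm_eq_sqrt_re_inner ℂ, @norm_eq_sqrt_re_inner ℂ, inner_preEmbed]
    refine C.denseRange_defectTo.induction (P := fun d =>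
      ‖(E.preEmbed.toLinearMap.extendOfNorm C.defectTo.toLinearMap) d‖ = ‖d‖) ?_ ?_ d
    · rintro _ ⟨x, rfl⟩
      rw [← hn]
      exact congrArg _ (LinearMap.extendOfNorm_eq (f := E.preEmbed.toLinearMap)
        (e := C.defectTo.toLinearMap) C.denseRange_defectTo ⟨1, fun x => by simp [hn]⟩ x)
    · exact isClosed_eq (by fun_prop) (by fun_prop)

theorem embedDefect_apply (x : L2 ι HC) : E.embedDefect (C.defectTo x) = E.preEmbed x := by
  have hn : ∀ x, ‖E.preEmbed x‖ = ‖C.defectTo x‖ := fun x => by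
    rw [@norm_eq_sqrt_re_inner ℂ, @norm_eq_sqrt_re_inner ℂ, inner_preEmbed]
  exact LinearMap.extendOfNorm_eq (f := E.preEmbed.toLinearMap)
        (e := C.defectTo.toLinearMap) C.denseRange_defectTo ⟨1, fun x => by simp [hn]⟩ x

theorem embedDefect_fst_fst (d : C.DefectSpace) : (E.embedDefect d).fst.fst = 0 := by
  have : ∀ z : E.Mid, z.fst.fst = WithLp.fstL 2 ℂ HC HA (WithLp.fstL 2 ℂ _ _ z) := fun z => rfl
  refine C.denseRange_defectTo.induction (P := fun d => (E.embedDefect d).fst.fst = 0) ?_ ?_ d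
  · rintro _ ⟨x, rfl⟩
    rw [embedDefect_apply, preEmbed_fst]; rfl
  · simp only [this]
    exact isClosed_eq (by fun_prop) (by fun_prop)

theorem inner_embedDefect_midOp (d : C.DefectSpace) (i : ι) (z : E.Mid) (hz : z.fst.fst = 0) :
    ⟪E.embedDefect d, E.midOp i z⟫_ℂ = 0 := by
  refine C.denseRange_defectTo.induction (P := fun d => ⟪E.embedDefect d, E.midOp i z⟫_ℂ = 0) ?_ ?_ d
  · rintro _ ⟨x, rfl⟩
    rw [embedDefect_apply, inner_preEmbed_midOp _ _ _ _ hz]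
  · exact isClosed_eq (by fun_prop) (by fun_prop)

theorem inner_midWord_self (α : List ι) (x y : E.Mid) :
    ⟪E.midWord α x, E.midWord α y⟫_ℂ = ⟪x, y⟫_ℂ := by
  induction α with
  | nil => rfl
  | cons i α ih => exact (E.inner_midOp_self i _ _).trans ih

theorem midWord_fst_fst (α : List ι) (z : E.Mid) (hz : z.fst.fst = 0) :
    (E.midWord α z).fst.fst = 0 := by
  induction α with
  | nil => exact hz
  | cons i α ih =>
    change (E.midOp i (E.midWord α z)).fst.fst = 0
    rw [RowContraction.midOp_fst, E.fst_op, ih, map_zero]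

/-- The isometry `d ↦ V^E_α d` on the copy of `𝒟_C` in the space of `V^E`. -/
def embedWord (α : List ι) : C.DefectSpace →ₗᵢ[ℂ] E.Mid where
  toLinearMap := (E.midWord α).toLinearMap ∘ₗ E.embedDefect.toLinearMap
  norm_map' d := by
    change ‖E.midWord α (E.embedDefect d)‖ = ‖d‖
    rw [← E.embedDefect.norm_map, @norm_eq_sqrt_re_inner ℂ, @norm_eq_sqrt_re_inner ℂ,
      inner_midWord_self]

theorem embedWord_apply (α : List ι) (d : C.DefectSpace) :
    E.embedWord α d = E.midWord α (E.embedDefect d) := rfl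

theorem orthogonal_embedWord : OrthogonalFamily ℂ (fun _ : List ι => C.DefectSpace) E.embedWord := by
  intro α
  induction α with
  | nil =>
    rintro (_ | ⟨j, β⟩) hne d d'
    · exact absurd rfl hne
    · exact E.inner_embedDefect_midOp _ _ _ (E.midWord_fst_fst β _ (E.embedDefect_fst_fst _))
  | cons i α ih =>
    rintro (_ | ⟨j, β⟩) hne d d'
    · rw [← inner_conj_symm]
      refine (congrArg _ ?_).trans (map_zero _)
      exact E.inner_embedDefect_midOp _ _ _ (E.midWord_fst_fst α _ (E.embedDefect_fst_fst _))
    · change ⟪E.midOp i (E.embedWord α d), E.midOp j (E.embedWord β d')⟫_ℂ = 0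
      by_cases hij : i = j
      · subst hij
        rw [RowContraction.inner_midOp_self]
        exact ih (fun h => hne (h ▸ rfl)) d d'
      · exact E.inner_midOp_of_ne hij _ _

/-- The isometric embedding of `Γ ⊗ 𝒟_C`, with `e_α ⊗ d ↦ V^E_α d`. -/
def embedFock : Fock ι C.DefectSpace →ₗᵢ[ℂ] E.Mid := E.orthogonal_embedWord.linearIsometry

theorem embedFock_single (α : List ι) (d : C.DefectSpace) :
    E.embedFock (L2.single α d) = E.embedWord α d := by
  classical
  have := E.orthogonal_embedWord.linearIsometry_apply_single (i := α) d
  rw [embedFock, L2.single_eq]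
  exact this

theorem embedFock_shift (i : ι) (f : Fock ι C.DefectSpace) :
    E.embedFock (Fock.shift i f) = E.midOp i (E.embedFock f) := by
  have h : E.embedFock.toContinuousLinearMap ∘L (Fock.shift i).toContinuousLinearMap =
      E.midOp i ∘L E.embedFock.toContinuousLinearMap := by
    refine L2.ext_single fun α d => ?_
    simp only [ContinuousLinearMap.comp_apply, LinearIsometry.coe_toContinuousLinearMap,
      Fock.shift_single, embedFock_single]
    rfl
  exact DFunLike.congr_fun h f

theorem embedFock_fst_fst (f : Fock ι C.DefectSpace) : (E.embedFock f).fst.fst = 0 := by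
  have h : WithLp.fstL 2 ℂ _ _ ∘L WithLp.fstL 2 ℂ _ _ ∘L E.embedFock.toContinuousLinearMap = 0 := by
    refine L2.ext_single fun α d => ?_
    simp only [ContinuousLinearMap.comp_apply, LinearIsometry.coe_toContinuousLinearMap,
      embedFock_single]
    exact E.midWord_fst_fst α _ (E.embedDefect_fst_fst d)
  exact DFunLike.congr_fun h f

theorem inner_inl_inl (h : HC) (z : E.Mid) : ⟪HSum.inl (HSum.inl h), z⟫_ℂ = ⟪h, z.fst.fst⟫_ℂ := by
  rw [HSum.inner_inl_left, HSum.inner_inl_left]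

/-- The embedding of the space of the minimal isometric dilation of `C`. -/
def embedMid : C.Mid →L[ℂ] E.Mid :=
  HSum.inl.toContinuousLinearMap ∘L HSum.inl.toContinuousLinearMap ∘L WithLp.fstL 2 ℂ _ _ +
    E.embedFock.toContinuousLinearMap ∘L WithLp.sndL 2 ℂ _ _

theorem embedMid_apply (x : C.Mid) :
    E.embedMid x = HSum.inl (HSum.inl x.fst) + E.embedFock x.snd := rfl

theorem inner_embedMid (x y : C.Mid) : ⟪E.embedMid x, E.embedMid y⟫_ℂ = ⟪x, y⟫_ℂ := by
  have h : ⟪E.embedFock x.snd, HSum.inl (HSum.inl y.fst)⟫_ℂ = 0 := by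
    rw [← inner_conj_symm, inner_inl_inl, embedFock_fst_fst]; simp
  rw [embedMid_apply, embedMid_apply, inner_add_left, inner_add_right, inner_add_right, h,
    inner_inl_inl, inner_inl_inl, embedFock_fst_fst, LinearIsometry.inner_map_map, HSum.inner_eq x]
  simp

theorem embedMid_inl (h : HC) : E.embedMid (HSum.inl h) = HSum.inl (HSum.inl h) := by
  simp [embedMid_apply]

theorem embedMid_midOp (i : ι) (x : C.Mid) : E.embedMid (C.midOp i x) = E.midOp i (E.embedMid x) := by
  rw [embedMid_apply, RowContraction.midOp_fst, RowContraction.midOp_snd, map_add, embedFock_shift,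
    embedMid_apply, map_add, Fock.vac, embedFock_single]
  change _ + (E.embedDefect _ + _) = _
  rw [embedDefect_apply, preEmbed_single]
  abel

theorem embedMid_midWord (α : List ι) (x : C.Mid) :
    E.embedMid (C.midWord α x) = E.midWord α (E.embedMid x) := by
  induction α with
  | nil => rfl
  | cons i α ih =>
    change E.embedMid (C.midOp i (C.midWord α x)) = E.midOp i (E.midWord α _)
    rw [embedMid_midOp, ih]

theorem inner_embedMid_residual (x : C.Mid) {k : E.Mid} (hk : k ∈ E.residual) :
    ⟪E.embedMid x, k⟫_ℂ = 0 := by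
  rw [mem_residual_iff] at hk
  have h1 : ∀ α : List ι, ∀ y, ⟪k, E.midWord α (E.preEmbed y)⟫_ℂ = 0 := fun α y => by
    have : innerSL ℂ k ∘L E.midWord α ∘L E.preEmbed = 0 := by
      refine L2.ext_single fun i h => ?_
      have h2 := hk (α ++ [i]) h
      have h3 : E.midWord (α ++ [i]) = E.midWord α ∘L E.midOp i := by
        simp [RowContraction.midWord, List.prod_append]; rfl
      rw [h3] at h2
      simp only [ContinuousLinearMap.comp_apply, innerSL_apply_apply, preEmbed_single, map_sub] at h2 ⊢
      rw [← inner_conj_symm, h2, ← inner_conj_symm, hk]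
      simp
    exact DFunLike.congr_fun this y
  have h2 : ∀ α : List ι, ∀ d, ⟪k, E.midWord α (E.embedDefect d)⟫_ℂ = 0 := fun α d => by
    refine C.denseRange_defectTo.induction
      (P := fun d => ⟪k, E.midWord α (E.embedDefect d)⟫_ℂ = 0) ?_ ?_ d
    · rintro _ ⟨x, rfl⟩
      rw [embedDefect_apply, h1]
    · exact isClosed_eq (by fun_prop) (by fun_prop)
  have h3 : innerSL ℂ k ∘L E.embedFock.toContinuousLinearMap = 0 := by
    refine L2.ext_single fun α d => ?_
    simp only [ContinuousLinearMap.comp_apply, LinearIsometry.coe_toContinuousLinearMap,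
      embedFock_single, innerSL_apply_apply, embedWord_apply, h2]
    rfl
  have h4 : ⟪k, E.embedFock x.snd⟫_ℂ = 0 := DFunLike.congr_fun h3 x.snd
  rw [embedMid_apply, inner_add_left, ← inner_conj_symm (E.embedFock _), h4]
  have h5 := hk [] x.fst
  change ⟪HSum.inl (HSum.inl x.fst), k⟫_ℂ = 0 at h5
  rw [h5]
  simp

/-- The unitary `W^* : (H_C ⊕ (Γ ⊗ 𝒟_C)) ⊕ 𝒦 → H_E ⊕ (Γ ⊗ 𝒟_E)`, as an isometry. -/
def decompIsometry : HSum C.Mid E.Residual →ₗᵢ[ℂ] E.Mid where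
  toLinearMap := (E.embedMid ∘L WithLp.fstL 2 ℂ _ _ +
    E.residualIncl.toContinuousLinearMap ∘L WithLp.sndL 2 ℂ _ _).toLinearMap
  norm_map' x := by
    change ‖E.embedMid x.fst + E.residualIncl x.snd‖ = ‖x‖
    have h := E.inner_embedMid_residual x.fst (E.residualIncl_mem x.snd)
    have h' : ⟪E.residualIncl x.snd, E.embedMid x.fst⟫_ℂ = 0 := by
      rw [← inner_conj_symm, h, map_zero]
    rw [@norm_eq_sqrt_re_inner ℂ, @norm_eq_sqrt_re_inner ℂ, inner_add_left, inner_add_right,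
      inner_add_right, h, h', inner_embedMid, HSum.inner_eq x, LinearIsometry.inner_map_map,
      add_zero, zero_add]

theorem decompIsometry_apply (y : HSum C.Mid E.Residual) :
    E.decompIsometry y = E.embedMid y.fst + E.residualIncl y.snd := rfl

theorem decompIsometry_inl (x : C.Mid) : E.decompIsometry (HSum.inl x) = E.embedMid x := by
  rw [decompIsometry_apply, HSum.inl_fst, HSum.inl_snd, map_zero, add_zero]

theorem decompIsometry_inr (k : E.Residual) : E.decompIsometry (HSum.inr k) = E.residualIncl k := by
  rw [decompIsometry_apply, HSum.inr_fst, HSum.inr_snd, map_zero, zero_add]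

theorem decompIsometry_midOp (i : ι) (y : HSum C.Mid E.Residual) :
    E.decompIsometry (HSum.inl (C.midOp i y.fst) + HSum.inr (E.residualOp i y.snd)) =
      E.midOp i (E.decompIsometry y) := by
  rw [map_add, decompIsometry_inl, decompIsometry_inr, embedMid_midOp, E.decompIsometry_apply y,
    map_add, residualIncl_residualOp]

theorem decompIsometry_surjective : Function.Surjective E.decompIsometry := by
  have hc : IsClosed (Set.range E.decompIsometry) :=
    E.decompIsometry.isometry.isClosedEmbedding.isClosed_range
  have : CompleteSpace (LinearMap.range E.decompIsometry.toLinearMap) :=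
    IsClosed.completeSpace_coe (s := Set.range E.decompIsometry)
  refine LinearMap.range_eq_top.1 ((Submodule.orthogonal_eq_bot_iff).1 ?_)
  refine (Submodule.eq_bot_iff _).2 fun z hz => ?_
  have h1 : ∀ x, ⟪E.decompIsometry x, z⟫_ℂ = 0 := fun x => hz _ ⟨x, rfl⟩
  have h2 : z ∈ E.residual := by
    refine (E.mem_residual_iff).2 fun α h => ?_
    have := h1 (HSum.inl (C.midWord α (HSum.inl h)))
    rwa [decompIsometry_inl, embedMid_midWord, embedMid_inl] at this
  obtain ⟨k, rfl⟩ : ∃ k : E.Residual, E.residualIncl k = z := ⟨⟨z, h2⟩, rfl⟩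
  have h3 := h1 (HSum.inr k)
  rw [decompIsometry_inr] at h3
  exact inner_self_eq_zero.1 h3

/-- The unitary `W : H_E ⊕ (Γ ⊗ 𝒟_E) → (H_C ⊕ (Γ ⊗ 𝒟_C)) ⊕ 𝒦`. It is characterized by the
following three facts: it is the identity on `H_C` and on `𝒦`, and it intertwines `V^E` with
`V^C ⊕ Y`. -/
def unitary : E.Mid ≃ₗᵢ[ℂ] HSum C.Mid E.Residual :=
  (LinearIsometryEquiv.ofSurjective _ E.decompIsometry_surjective).symm

theorem unitary_symm_apply (y : HSum C.Mid E.Residual) : E.unitary.symm y = E.decompIsometry y := by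
  rw [unitary, LinearIsometryEquiv.symm_symm]
  rfl

theorem unitary_inl_inl (h : HC) : E.unitary (HSum.inl (HSum.inl h)) = HSum.inl (HSum.inl h) := by
  rw [← LinearIsometryEquiv.eq_symm_apply, unitary_symm_apply, decompIsometry_inl, embedMid_inl]

theorem unitary_residual (k : E.Residual) : E.unitary (E.residualIncl k) = HSum.inr k := by
  rw [← LinearIsometryEquiv.eq_symm_apply, unitary_symm_apply, decompIsometry_inr]

theorem unitary_midOp (i : ι) (x : E.Mid) : E.unitary (E.midOp i x) =
    HSum.inl (C.midOp i (E.unitary x).fst) + HSum.inr (E.residualOp i (E.unitary x).snd) := by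
  rw [← LinearIsometryEquiv.eq_symm_apply, unitary_symm_apply, decompIsometry_midOp,
    ← unitary_symm_apply, LinearIsometryEquiv.symm_apply_apply]

/-- The operator `P_{Γ ⊗ 𝒟_C} W`. -/
def projFockUnitary : E.Mid →L[ℂ] Fock ι C.DefectSpace :=
  WithLp.sndL 2 ℂ _ _ ∘L WithLp.fstL 2 ℂ _ _ ∘L E.unitary.toContinuousLinearEquiv.toContinuousLinearMap

/-- The operator `P_𝒦 W`. -/
def projResidualUnitary : E.Mid →L[ℂ] E.Residual :=
  WithLp.sndL 2 ℂ _ _ ∘L E.unitary.toContinuousLinearEquiv.toContinuousLinearMap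

/-- The operator `P_{e_0 ⊗ 𝒟_C} W |_{H_A} : H_A → 𝒟_C`. -/
def vacCoeff : HA →L[ℂ] C.DefectSpace :=
  L2.proj [] ∘L E.projFockUnitary ∘L HSum.inl.toContinuousLinearMap ∘L HSum.inr.toContinuousLinearMap

theorem vacCoeff_apply (a : HA) :
    E.vacCoeff a = (E.unitary (HSum.inl (HSum.inr a))).fst.snd [] := rfl

theorem inner_vacCoeff (d : C.DefectSpace) (a : HA) :
    ⟪d, E.vacCoeff a⟫_ℂ = ⟪E.embedDefect d, HSum.inl (HSum.inr a)⟫_ℂ := by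
  have h1 : E.unitary.symm (HSum.inl (HSum.inr (Fock.vac d))) = E.embedDefect d := by
    rw [unitary_symm_apply, decompIsometry_inl, embedMid_apply, HSum.inr_fst, HSum.inr_snd,
      Fock.vac, embedFock_single, map_zero, map_zero, zero_add]
    rfl
  have h2 := LinearIsometryEquiv.inner_map_map (𝕜 := ℂ) E.unitary.symm (HSum.inl (HSum.inr (Fock.vac d)))
    (E.unitary (HSum.inl (HSum.inr a)))
  rw [h1, LinearIsometryEquiv.symm_apply_apply] at h2
  rw [h2, HSum.inner_inl_left, HSum.inner_inr_left, Fock.vac, L2.inner_single_left, vacCoeff_apply]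

theorem norm_vacCoeff_le (a : HA) : ‖E.vacCoeff a‖ ≤ ‖E.corner.defectStarTo a‖ := by
  set d := E.vacCoeff a with hd
  have hsum : ∀ s : Finset ι, ‖d‖ ^ 2 + ∑ i ∈ s, ‖adjoint (E.corner.op i) a‖ ^ 2 ≤ ‖a‖ ^ 2 := by
    intro s
    have h := add_sum_le_norm_sq (E.embedDefect d) (HSum.inl (HSum.inr a))
      (fun i => E.midOp i (HSum.inl (HSum.inr (adjoint (E.corner.op i) a)))) (‖d‖ ^ 2)
      (fun i => ‖adjoint (E.corner.op i) a‖ ^ 2) s ?_ ?_ ?_ ?_ ?_ ?_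
    · rwa [LinearIsometry.norm_map, LinearIsometry.norm_map] at h
    · rw [LinearIsometry.inner_map_map, inner_self_eq_norm_sq_to_K]; simp
    · rw [← inner_vacCoeff, ← hd, inner_self_eq_norm_sq_to_K]; simp
    · exact fun i => E.inner_embedDefect_midOp _ _ _ (by simp)
    · intro i
      rw [RowContraction.inner_midOp_self, LinearIsometry.inner_map_map,
        LinearIsometry.inner_map_map, inner_self_eq_norm_sq_to_K]; simp
    · intro i
      rw [RowContraction.inner_midOp_inl, LinearIsometry.inner_map_map, HSum.inner_inr_left,
        ← E.adjoint_cornerOp]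
      change ⟪_, adjoint (E.corner.op i) a⟫_ℂ = _
      rw [inner_self_eq_norm_sq_to_K]; simp
    · exact fun i j hij => E.inner_midOp_of_ne hij _ _
  have hlim : ‖d‖ ^ 2 + ‖adjoint E.corner.row a‖ ^ 2 ≤ ‖a‖ ^ 2 := by
    have h := L2.hasSum_norm_sq (adjoint E.corner.row a)
    have h' : ‖adjoint E.corner.row a‖ ^ 2 ≤ ‖a‖ ^ 2 - ‖d‖ ^ 2 := by
      refine hasSum_le_of_sum_le h fun s => ?_
      have := hsum s
      simp only [RowContraction.adjoint_row_apply]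
      linarith
    linarith
  refine (sq_le_sq₀ (norm_nonneg _) (norm_nonneg _)).1 ?_
  rw [RowContraction.norm_defectStar_sq]
  linarith

/-- The contraction `γ : 𝒟_{*,A} → 𝒟_C`, the continuous extension of
`D_{*,A} a ↦ P_{e_0 ⊗ 𝒟_C} W a` to the closed range of `D_{*,A}`. -/
def gamma : E.corner.DefectStarSpace →L[ℂ] C.DefectSpace :=
  E.vacCoeff.toLinearMap.extendOfNorm E.corner.defectStarTo.toLinearMap

theorem gamma_defectStarTo (a : HA) : E.gamma (E.corner.defectStarTo a) = E.vacCoeff a :=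
  LinearMap.extendOfNorm_eq (f := E.vacCoeff.toLinearMap)
    (e := E.corner.defectStarTo.toLinearMap) E.corner.denseRange_defectStarTo
    ⟨1, fun x => by simpa using E.norm_vacCoeff_le x⟩ a

/-- `γ` is resolving. -/
def IsResolving : Prop :=
  ∀ a : HA, (∀ α : List ι, E.gamma (E.corner.defectStarTo (adjoint (E.corner.word α) a)) = 0) →
    ∀ α : List ι, E.corner.defectStarTo (adjoint (E.corner.word α) a) = 0

/-- A lifting of `C` by `A` is reduced if `A` is completely non-coisometric and `γ` is resolving. -/
def IsReduced : Prop := E.corner.IsCompletelyNonCoisometric ∧ E.IsResolving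

/-- The characteristic function `M_{C,E} = P_{Γ ⊗ 𝒟_C} W |_{Γ ⊗ 𝒟_E}`. -/
def charFun : Fock ι E.DefectSpace →L[ℂ] Fock ι C.DefectSpace :=
  E.projFockUnitary ∘L HSum.inr.toContinuousLinearMap

theorem unitary_fst_fst (z : E.Mid) : (E.unitary z).fst.fst = z.fst.fst := by
  refine ext_inner_left ℂ fun h => ?_
  rw [← inner_inl_inl, ← HSum.inner_inl_left, ← HSum.inner_inl_left (K := E.Residual),
    ← unitary_inl_inl]
  exact LinearIsometryEquiv.inner_map_map (𝕜 := ℂ) E.unitary _ _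

/-- The characteristic function is multi-analytic: `M (L_i ⊗ 1) = (L_i ⊗ 1) M`. -/
theorem charFun_shift (i : ι) (x : Fock ι E.DefectSpace) :
    E.charFun (Fock.shift i x) = Fock.shift i (E.charFun x) := by
  have h1 : (HSum.inr (Fock.shift i x) : E.Mid) = E.midOp i (HSum.inr x) := by
    rw [RowContraction.midOp_apply, HSum.inr_fst, HSum.inr_snd]
    simp
  have h2 : ∀ z, E.projFockUnitary z = (E.unitary z).fst.snd := fun _ => rfl
  have h3 : (E.unitary (E.midOp i (HSum.inr x))).fst = C.midOp i (E.unitary (HSum.inr x)).fst := by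
    rw [unitary_midOp, WithLp.add_fst, HSum.inl_fst, HSum.inr_fst, add_zero]
  change E.projFockUnitary (HSum.inr (Fock.shift i x)) = Fock.shift i (E.projFockUnitary (HSum.inr x))
  rw [h1, h2, h2, h3, RowContraction.midOp_snd, unitary_fst_fst, HSum.inr_fst, WithLp.zero_fst,
    map_zero, map_zero, map_zero, zero_add]

/-- The functional model of `E` built from `C` and `M = M_{C,E}`, with `Δ = (1 - M* M)^{1/2}`.
There are a unitary `τ : 𝒦 → closure (range Δ)`, with `τ P_𝒦 W x = Δ x` for `x ∈ Γ ⊗ 𝒟_E`, and operators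
`Y_i` on `closure (range Δ)`, with `Y_i Δ x = Δ (L_i ⊗ 1) x`, corresponding under `τ` to the operators
`Y_i` on `𝒦`, such that
* `(1 ⊕ τ) W` maps `H_A` onto the subspace
  `[(Γ ⊗ 𝒟_C) ⊕ closure (range Δ)] ⊖ {M x ⊕ Δ x : x ∈ Γ ⊗ 𝒟_E}`, and
* `(1 ⊕ τ) W` transforms `E_i*` on `H_E` into the restriction of `(V_i^C ⊕ Y_i)*`. -/
def HasFunctionalModel : Prop :=
  ∃ (τ : E.Residual ≃ₗᵢ[ℂ] DeltaSpace E.charFun)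
    (Y : ι → DeltaSpace E.charFun →L[ℂ] DeltaSpace E.charFun),
    (∀ x : Fock ι E.DefectSpace, τ (E.projResidualUnitary (HSum.inr x)) = delta E.charFun x) ∧
    (∀ i x, Y i (delta E.charFun x) = delta E.charFun (Fock.shift i x)) ∧
    (∀ i k, τ (E.residualOp i k) = Y i (τ k)) ∧
    {y : ModelSpace E.charFun | ∃ a : HA,
        y.fst = E.projFockUnitary (HSum.inl (HSum.inr a)) ∧
        y.snd = τ (E.projResidualUnitary (HSum.inl (HSum.inr a)))} =
      (modelSubspace E.charFun : Set (ModelSpace E.charFun)) ∧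
    ∀ (i : ι) (h : HSum HC HA),
      (E.unitary (HSum.inl (adjoint (E.op i) h))).fst =
        adjoint (C.midOp i) (E.unitary (HSum.inl h)).fst ∧
      τ (E.projResidualUnitary (HSum.inl (adjoint (E.op i) h))) =
        adjoint (Y i) (τ (E.projResidualUnitary (HSum.inl h)))

/-- Unitary equivalence of liftings of `C`: there is a unitary `u : H_E → H_{E'}` which is the
identity on `H_C` and satisfies `E'_i u = u E_i` for all `i`. -/
def UnitarilyEquivalent {HA' : Type*} [NormedAddCommGroup HA'] [InnerProductSpace ℂ HA']
    [CompleteSpace HA'] (E : ContractiveLifting C HA) (E' : ContractiveLifting C HA') : Prop :=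
  ∃ u : HSum HC HA ≃ₗᵢ[ℂ] HSum HC HA', (∀ h : HC, u (HSum.inl h) = HSum.inl h) ∧
    ∀ i x, E'.op i (u x) = u (E.op i x)

end ContractiveLifting

end

/-! Everything rests on the position of $\Gamma\otimes\mathcal D_E$ on the other side of the unitary
$W$. A vector $x\in\Gamma\otimes\mathcal D_E$ has no $\mathcal H_C$-component, so $Wx=0\oplus
Mx\oplus P_{\mathcal K}Wx$ with $M=M_{C,E}$, and Pythagoras gives $\|P_{\mathcal
K}Wx\|^2=\|x\|^2-\|Mx\|^2=\|\Delta x\|^2$ (`norm_projResidualUnitary_sq`). If the vectors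
$P_{\mathcal K}Wx$ are dense in $\mathcal K$, then $P_{\mathcal K}Wx\mapsto\Delta x$ extends to the
unitary $\tau$. So $M$ determines how $\Gamma\otimes\mathcal D_E$ is embedded, and $W\mathcal H_E$
is its orthogonal complement.

The density is what reducedness provides (`IsReduced.denseRange_projResidualUnitary`). A vector of
$\mathcal K$ orthogonal to all $P_{\mathcal K}Wx$ is some $a\in\mathcal H_A$ whose image under $W$
has no component in $\Gamma\otimes\mathcal D_C$. The component of $Wa$ at $e_\alpha$ is $\gamma
D_{*,A}A_\alpha^*a$ (`projFockUnitary_inr_apply`). Since $\gamma$ is resolving, all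
$D_{*,A}A_\alpha^*a$ vanish; then $\sum_{|\alpha|=n}\|A_\alpha^*a\|^2=\|a\|^2$ for every $n$, and
$a=0$ by complete non-coisometricity.

For the equivalence, a unitary $u$ between liftings induces a unitary $v$ of the defect spaces, and
$u\oplus(1\otimes v)$ carries one dilation to the other, together with the embedded dilation of
$\underline C$; this gives $\Theta=\Theta'v$, without reducedness. Conversely $\Theta=\Theta'v$
gives $M=M'(1\otimes v)$, hence by density a unitary $\sigma:\mathcal K\to\mathcal K'$. The unitary
$W'^*(1\oplus\sigma)W$ intertwines the dilations and extends $1\otimes v$, so it restricts to a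
unitary $u$ of the complements $\mathcal H_E$ and $\mathcal H_{E'}$. -/

/-- Equality of norms makes $f(x)\mapsto g(x)$ well defined and isometric on a dense subspace. The
unitaries $\tau$, $v$ and $\sigma$ all arise in this way. -/
theorem exists_linearIsometryEquiv_of_denseRange {X K K' : Type*} [NormedAddCommGroup X]
    [NormedSpace ℂ X] [NormedAddCommGroup K] [InnerProductSpace ℂ K] [CompleteSpace K]
    [NormedAddCommGroup K'] [InnerProductSpace ℂ K'] [CompleteSpace K']
    (f : X →L[ℂ] K) (g : X →L[ℂ] K') (hf : DenseRange f) (hg : DenseRange g)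
    (hfg : ∀ x, ‖g x‖ = ‖f x‖) : ∃ σ : K ≃ₗᵢ[ℂ] K', ∀ x, σ (f x) = g x := by
  have hext : ∀ x, g.toLinearMap.extendOfNorm f.toLinearMap (f x) = g x :=
    LinearMap.extendOfNorm_eq (f := g.toLinearMap) (e := f.toLinearMap) hf
      ⟨1, fun x => by simp [hfg]⟩
  let σ : K →ₗᵢ[ℂ] K' :=
    { toLinearMap := (g.toLinearMap.extendOfNorm f.toLinearMap).toLinearMap
      norm_map' := fun k => by
        refine hf.induction
          (P := fun k => ‖g.toLinearMap.extendOfNorm f.toLinearMap k‖ = ‖k‖) ?_ ?_ k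
        · rintro _ ⟨x, rfl⟩
          rw [hext, hfg]
        · exact isClosed_eq (by fun_prop) (by fun_prop) }
  have hσ : ∀ x, σ (f x) = g x := hext
  have hsurj : Function.Surjective σ := fun k' => by
    -- The range of an isometry on a complete space is closed, and this one contains the dense range
    -- of `g`.
    have hc : IsClosed (Set.range σ) := σ.isometry.isClosedEmbedding.isClosed_range
    refine hg.induction (P := fun k' => k' ∈ Set.range σ) ?_ hc k'
    rintro _ ⟨x, rfl⟩
    exact ⟨f x, hσ x⟩
  exact ⟨LinearIsometryEquiv.ofSurjective σ hsurj, hσ⟩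

/-! ### Unitaries on Hilbert space sums, and multi-analytic operators -/

section HilbertSums

variable {ι H H' K K' : Type*} [NormedAddCommGroup H] [InnerProductSpace ℂ H]
  [NormedAddCommGroup H'] [InnerProductSpace ℂ H'] [NormedAddCommGroup K]
  [InnerProductSpace ℂ K] [NormedAddCommGroup K'] [InnerProductSpace ℂ K']

theorem HSum.ext {H K : Type*} {x y : HSum H K} (h₁ : x.fst = y.fst) (h₂ : x.snd = y.snd) : x = y :=
  WithLp.ofLp_injective 2 (Prod.ext h₁ h₂)

theorem HSum.inl_add_inr (x : HSum H K) : HSum.inl x.fst + HSum.inr x.snd = x :=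
  HSum.ext (by simp) (by simp)

theorem HSum.norm_sq_eq {H K : Type*} [NormedAddCommGroup H]
    [NormedAddCommGroup K] (x : HSum H K) : ‖x‖ ^ 2 = ‖x.fst‖ ^ 2 + ‖x.snd‖ ^ 2 :=
  WithLp.prod_norm_sq_eq_of_L2 x

/-- The direct sum of two unitaries. -/
noncomputable def HSum.congr (u : H ≃ₗᵢ[ℂ] H') (w : K ≃ₗᵢ[ℂ] K') : HSum H K ≃ₗᵢ[ℂ] HSum H' K' where
  toFun x := WithLp.toLp 2 (u x.fst, w x.snd)
  invFun x := WithLp.toLp 2 (u.symm x.fst, w.symm x.snd)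
  map_add' x y := HSum.ext (by simp) (by simp)
  map_smul' c x := HSum.ext (by simp) (by simp)
  left_inv x := HSum.ext (by simp) (by simp)
  right_inv x := HSum.ext (by simp) (by simp)
  norm_map' x := by
    refine (sq_eq_sq₀ (norm_nonneg _) (norm_nonneg _)).1 ?_
    rw [HSum.norm_sq_eq, HSum.norm_sq_eq]
    simp

@[simp] theorem HSum.congr_fst (u : H ≃ₗᵢ[ℂ] H') (w : K ≃ₗᵢ[ℂ] K') (x : HSum H K) :
    (HSum.congr u w x).fst = u x.fst := rfl

@[simp] theorem HSum.congr_snd (u : H ≃ₗᵢ[ℂ] H') (w : K ≃ₗᵢ[ℂ] K') (x : HSum H K) :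
    (HSum.congr u w x).snd = w x.snd := rfl

/-- A unitary between direct sums which maps the second summand onto the second summand also maps
the first summand onto the first summand. -/
theorem HSum.exists_restrict_fst (U : HSum H K ≃ₗᵢ[ℂ] HSum H' K') (w : K ≃ₗᵢ[ℂ] K')
    (hU : ∀ k, U (HSum.inr k) = HSum.inr (w k)) :
    ∃ u : H ≃ₗᵢ[ℂ] H', ∀ h, U (HSum.inl h) = HSum.inl (u h) := by
  -- $U(h\oplus0)$ is orthogonal to $U(0\oplus k)=0\oplus wk$, and $w$ is onto. The same argument
  -- for $U^{-1}$ yields surjectivity of the restriction.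
  have h1 : ∀ h, U (HSum.inl h) = HSum.inl (U (HSum.inl h)).fst := fun h => by
    refine HSum.ext rfl (ext_inner_left ℂ fun k' => ?_)
    rw [← HSum.inner_inr_left, ← w.apply_symm_apply k', ← hU, U.inner_map_map]
    simp
  have h2 : ∀ h', U.symm (HSum.inl h') = HSum.inl (U.symm (HSum.inl h')).fst := fun h' => by
    refine HSum.ext rfl (ext_inner_left ℂ fun k => ?_)
    rw [← HSum.inner_inr_left, ← U.inner_map_map, hU]
    simp
  let u : H →ₗᵢ[ℂ] H' :=
    { toFun := fun h => (U (HSum.inl h)).fst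
      map_add' := fun x y => by simp
      map_smul' := fun c x => by simp
      norm_map' := fun h => by
        change ‖(U (HSum.inl h)).fst‖ = ‖h‖
        rw [← (HSum.inl (K := K')).norm_map (U (HSum.inl h)).fst, ← h1, U.norm_map,
          LinearIsometry.norm_map] }
  have hu : Function.Surjective u := fun h' => ⟨(U.symm (HSum.inl h')).fst, by
    change (U (HSum.inl (U.symm (HSum.inl h')).fst)).fst = h'
    rw [← h2, U.apply_symm_apply, HSum.inl_fst]⟩
  exact ⟨LinearIsometryEquiv.ofSurjective u hu, h1⟩

/-- The diagonal extension of a unitary. -/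
noncomputable def L2.congr (ι : Type*) (g : H ≃ₗᵢ[ℂ] K) : L2 ι H ≃ₗᵢ[ℂ] L2 ι K :=
  LinearIsometryEquiv.ofSurjective (L2.map g.toLinearIsometry) fun f =>
    ⟨L2.map g.symm.toLinearIsometry f, Subtype.ext (funext fun i => g.apply_symm_apply (f i))⟩

theorem L2.congr_apply (g : H ≃ₗᵢ[ℂ] K) (f : L2 ι H) (i : ι) : L2.congr ι g f i = g (f i) := rfl

theorem L2.congr_single (g : H ≃ₗᵢ[ℂ] K) (i : ι) (h : H) :
    L2.congr ι g (L2.single i h) = L2.single i (g h) :=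
  L2.map_single g.toLinearIsometry i h

theorem Fock.shift_congr (g : H ≃ₗᵢ[ℂ] K) (i : ι) (f : Fock ι H) :
    L2.congr _ g (Fock.shift i f) = Fock.shift i (L2.congr _ g f) := by
  refine DFunLike.congr_fun (f := (L2.congr (List ι) g).toContinuousLinearEquiv.toContinuousLinearMap
    ∘L (Fock.shift i).toContinuousLinearMap) (g := (Fock.shift i).toContinuousLinearMap
    ∘L (L2.congr (List ι) g).toContinuousLinearEquiv.toContinuousLinearMap)
    (L2.ext_single fun α d => ?_) f
  change L2.congr _ g (Fock.shift i (L2.single α d)) = Fock.shift i (L2.congr _ g (L2.single α d))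
  rw [Fock.shift_single, L2.congr_single, L2.congr_single, Fock.shift_single]

end HilbertSums

/-- Multi-analytic operators with equivalent symbols differ by the unitary `1 ⊗ v`. -/
theorem apply_eq_apply_congr_of_symbol_eq {ι D D' K : Type*} [NormedAddCommGroup D]
    [InnerProductSpace ℂ D] [NormedAddCommGroup D'] [InnerProductSpace ℂ D']
    [NormedAddCommGroup K] [InnerProductSpace ℂ K]
    {M : Fock ι D →L[ℂ] Fock ι K} {M' : Fock ι D' →L[ℂ] Fock ι K}
    (hM : ∀ i x, M (Fock.shift i x) = Fock.shift i (M x))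
    (hM' : ∀ i x, M' (Fock.shift i x) = Fock.shift i (M' x)) (v : D ≃ₗᵢ[ℂ] D')
    (hv : ∀ d, symbol M d = symbol M' (v d)) (x : Fock ι D) : M x = M' (L2.congr _ v x) := by
  refine DFunLike.congr_fun (f := M)
    (g := M' ∘L (L2.congr (List ι) v).toContinuousLinearEquiv.toContinuousLinearMap)
    (L2.ext_single fun α d => ?_) x
  change M (L2.single α d) = M' (L2.congr _ v (L2.single α d))
  rw [L2.congr_single]
  -- Since $e_{i\alpha}\otimes d=(L_i\otimes1)(e_\alpha\otimes d)$, commutation with the shifts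
  -- reduces every word to the vacuum, where the symbols are compared.
  induction α with
  | nil => exact hv d
  | cons i α ih => rw [← Fock.shift_single, ← Fock.shift_single, hM, hM', ih]

/-- Contractivity makes $1-M^*M$ positive, which is needed for `CFC.sqrt` to be a genuine square
root. -/
theorem norm_delta_sq {ι D K : Type*} [NormedAddCommGroup D] [InnerProductSpace ℂ D]
    [CompleteSpace D] [NormedAddCommGroup K] [InnerProductSpace ℂ K] [CompleteSpace K]
    {M : Fock ι D →L[ℂ] Fock ι K} (hM : ∀ x, ‖M x‖ ≤ ‖x‖) (x : Fock ι D) :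
    ‖delta M x‖ ^ 2 = ‖x‖ ^ 2 - ‖M x‖ ^ 2 := by
  have := congrArg Complex.re (inner_sqrtCompl hM x x)
  simp only [inner_self_eq_norm_sq_to_K, Complex.sub_re] at this
  exact_mod_cast this

/-! ### Adjoints in the dilation, and complete non-coisometricity -/

namespace RowContraction

variable {ι H : Type*} [NormedAddCommGroup H] [InnerProductSpace ℂ H] [CompleteSpace H]
  (T : RowContraction ι H)

/-- The space of $\underline T$ is invariant under the adjoints of its dilation. This turns the
model statement about $E_i^*$ into one about $(V_i^E)^*$. -/
theorem adjoint_midOp_inl (i : ι) (h : H) :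
    adjoint (T.midOp i) (HSum.inl h) = HSum.inl (adjoint (T.op i) h) :=
  ext_inner_left ℂ fun x => by rw [ContinuousLinearMap.adjoint_inner_right, inner_midOp_inl]

theorem midOp_inr (i : ι) (x : Fock ι T.DefectSpace) :
    T.midOp i (HSum.inr x) = HSum.inr (Fock.shift i x) := by
  rw [midOp_apply, HSum.inr_fst, HSum.inr_snd]
  simp

theorem adjoint_word_nil (h : H) : adjoint (T.word []) h = h :=
  ext_inner_left ℂ fun x => by rw [ContinuousLinearMap.adjoint_inner_right]; rfl

theorem adjoint_word_cons (i : ι) (α : List ι) (h : H) :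
    adjoint (T.word (i :: α)) h = adjoint (T.word α) (adjoint (T.op i) h) := by
  have : T.word (i :: α) = T.op i ∘L T.word α := by simp [word]; rfl
  rw [this, ContinuousLinearMap.adjoint_comp]
  rfl

/-- Immediate from $\|D_*h\|^2=\|h\|^2-\|\underline T^*h\|^2$; it is the one-letter step of the
induction on word length. -/
theorem hasSum_norm_sq_of_defectStarTo_eq_zero {h : H} (hh : T.defectStarTo h = 0) :
    HasSum (fun i => ‖adjoint (T.op i) h‖ ^ 2) (‖h‖ ^ 2) := by
  have h1 := T.norm_defectStar_sq h
  have h2 := L2.hasSum_norm_sq (adjoint T.row h)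
  simp only [adjoint_row_apply] at h2
  rw [hh, norm_zero] at h1
  rwa [show ‖h‖ ^ 2 = ‖adjoint T.row h‖ ^ 2 by linarith]

/-- If `D_* T_α* h = 0` for all words `α`, then `∑_{|α| = n} ‖T_α* h‖² = ‖h‖²`. -/
theorem hasSum_word_of_defectStarTo_eq_zero (n : ℕ) :
    ∀ h : H, (∀ α : List ι, T.defectStarTo (adjoint (T.word α) h) = 0) →
      HasSum (fun α : {α : List ι // α.length = n} => ‖adjoint (T.word α) h‖ ^ 2) (‖h‖ ^ 2) := by
  induction n with
  | zero =>
    intro h _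
    convert! hasSum_single (f := fun α : {α : List ι // α.length = 0} =>
      ‖adjoint (T.word α) h‖ ^ 2) ⟨[], rfl⟩ fun α hα => ?_ using 1
    · simp [adjoint_word_nil]
    · exact absurd (Subtype.ext (List.length_eq_zero_iff.1 α.2)) hα
  | succ n ih =>
    intro h hh
    -- Splitting off the first letter suits the adjoints: $T_{i\alpha}^*=T_\alpha^*T_i^*$, so the
    -- induction hypothesis applies to each $T_i^*h$.
    let e : (Σ _ : ι, {α : List ι // α.length = n}) ≃ {α : List ι // α.length = n + 1} :=
      { toFun := fun p => ⟨p.1 :: p.2.1, by simp [p.2.2]⟩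
        invFun := fun α => ⟨α.1.head (List.ne_nil_of_length_eq_add_one α.2), α.1.tail,
          by simp [α.2]⟩
        left_inv := fun p => rfl
        right_inv := fun α => Subtype.ext (List.cons_head_tail _) }
    rw [← e.hasSum_iff]
    have h1 : ∀ i, HasSum (fun α : {α : List ι // α.length = n} =>
        ‖adjoint (T.word (i :: α.1)) h‖ ^ 2) (‖adjoint (T.op i) h‖ ^ 2) := fun i => by
      simp only [adjoint_word_cons]
      exact ih _ fun α => by rw [← adjoint_word_cons]; exact hh _
    have h2 := T.hasSum_norm_sq_of_defectStarTo_eq_zero (h := h) (by simpa only [adjoint_word_nil] using hh [])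
    -- The alphabet may be infinite, so summability over all words of length $n+1$ is obtained
    -- first, from nonnegativity and summability of the fibre sums $\|T_i^*h\|^2$.
    have h3 : Summable ((fun α : {α : List ι // α.length = n + 1} =>
        ‖adjoint (T.word α) h‖ ^ 2) ∘ e) := by
      refine (summable_sigma_of_nonneg fun p => sq_nonneg _).2 ⟨fun i => (h1 i).summable, ?_⟩
      exact h2.summable.congr fun i => (h1 i).tsum_eq.symm
    rw [← (h3.hasSum.sigma h1).unique h2]
    exact h3.hasSum

theorem IsCompletelyNonCoisometric.eq_zero {T : RowContraction ι H}
    (hT : T.IsCompletelyNonCoisometric) {h : H}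
    (hh : ∀ α : List ι, T.defectStarTo (adjoint (T.word α) h) = 0) : h = 0 :=
  hT h fun n => T.hasSum_word_of_defectStarTo_eq_zero n h hh

end RowContraction

/-! ### Coefficients of $W$ on $\mathcal H_A$, and density in $\mathcal K$ -/

namespace ContractiveLifting

variable {ι HC HA HA' : Type*} [NormedAddCommGroup HC] [InnerProductSpace ℂ HC] [CompleteSpace HC]
  [NormedAddCommGroup HA] [InnerProductSpace ℂ HA] [CompleteSpace HA]
  [NormedAddCommGroup HA'] [InnerProductSpace ℂ HA'] [CompleteSpace HA'] {C : RowContraction ι HC}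
  (E : ContractiveLifting C HA) (E' : ContractiveLifting C HA')

/-- `embedFock` is the restriction of $W^*$ to $\Gamma\otimes\mathcal D_C$, hence the adjoint of
$P_{\Gamma\otimes\mathcal D_C}W$. -/
theorem inner_embedFock (f : Fock ι C.DefectSpace) (z : E.Mid) :
    ⟪E.embedFock f, z⟫_ℂ = ⟪f, E.projFockUnitary z⟫_ℂ := by
  have h : E.embedFock f = E.unitary.symm (HSum.inl (HSum.inr f)) := by
    rw [unitary_symm_apply, decompIsometry_inl, embedMid_apply, HSum.inr_fst, HSum.inr_snd, map_zero,
      map_zero, zero_add]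
  rw [h, ← LinearIsometryEquiv.inner_map_map (𝕜 := ℂ) E.unitary,
    LinearIsometryEquiv.apply_symm_apply, HSum.inner_inl_left, HSum.inner_inr_left]
  rfl

/-- Moving $V_i^E$ across the inner product replaces $a$ by $E_i^*a$. Its $\mathcal H_C$-component
is orthogonal to $V_\alpha^E\mathcal D_C$, and only $A_i^*a$ remains. -/
theorem inner_embedWord_inr (α : List ι) (a : HA) (d : C.DefectSpace) :
    ⟪E.embedWord α d, HSum.inl (HSum.inr a)⟫_ℂ =
      ⟪E.embedDefect d, HSum.inl (HSum.inr (adjoint (E.corner.word α) a))⟫_ℂ := by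
  induction α generalizing a with
  | nil => rw [RowContraction.adjoint_word_nil]; rfl
  | cons i α ih =>
    rw [RowContraction.adjoint_word_cons, ← ih]
    change ⟪E.midOp i (E.embedWord α d), _⟫_ℂ = _
    rw [RowContraction.inner_midOp_inl, ← HSum.inl_add_inr (adjoint (E.op i) (HSum.inr a)),
      ← E.adjoint_cornerOp, map_add, inner_add_right]
    have h0 : (E.embedWord α d).fst.fst = 0 := E.midWord_fst_fst α _ (E.embedDefect_fst_fst d)
    rw [← inner_conj_symm, E.inner_inl_inl, h0, inner_zero_right, map_zero, zero_add]
    rfl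

/-- The component of `W a` at `e_α ⊗ 𝒟_C`, for `a ∈ H_A`. -/
theorem projFockUnitary_inr_apply (α : List ι) (a : HA) :
    E.projFockUnitary (HSum.inl (HSum.inr a)) α = E.vacCoeff (adjoint (E.corner.word α) a) :=
  ext_inner_left ℂ fun d => by
    rw [inner_vacCoeff, ← inner_embedWord_inr, ← embedFock_single, inner_embedFock,
      L2.inner_single_left]

variable {E} in
-- Both halves of reducedness are used here directly: resolving removes $\gamma$ from $\gamma
-- D_{*,A}A_\alpha^*a=0$, then complete non-coisometricity gives $a=0$. All later uses of
-- reducedness pass through this lemma.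
theorem IsReduced.eq_zero (hE : E.IsReduced) {a : HA}
    (ha : E.projFockUnitary (HSum.inl (HSum.inr a)) = 0) : a = 0 := by
  refine hE.1.eq_zero (hE.2 a fun α => ?_)
  rw [gamma_defectStarTo, ← projFockUnitary_inr_apply, ha]
  rfl

theorem inner_projResidualUnitary (k : E.Residual) (z : E.Mid) :
    ⟪k, E.projResidualUnitary z⟫_ℂ = ⟪E.residualIncl k, z⟫_ℂ := by
  rw [← LinearIsometryEquiv.inner_map_map (𝕜 := ℂ) E.unitary, unitary_residual,
    HSum.inner_inr_left]
  rfl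

theorem residualIncl_fst_fst (k : E.Residual) : (E.residualIncl k).fst.fst = 0 := by
  rw [← unitary_fst_fst, unitary_residual, HSum.inr_fst, WithLp.zero_fst]

theorem unitary_fst_fst_inr (x : Fock ι E.DefectSpace) : (E.unitary (HSum.inr x)).fst.fst = 0 := by
  rw [unitary_fst_fst, HSum.inr_fst, WithLp.zero_fst]

variable {E} in
/-- `P_𝒦 W (Γ ⊗ 𝒟_E)` is dense in `𝒦`. -/
theorem IsReduced.denseRange_projResidualUnitary (hE : E.IsReduced) :
    DenseRange (E.projResidualUnitary ∘L
      (HSum.inr (H := HSum HC HA) (K := Fock ι E.DefectSpace)).toContinuousLinearMap) := by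
  set f := E.projResidualUnitary ∘L
    (HSum.inr (H := HSum HC HA) (K := Fock ι E.DefectSpace)).toContinuousLinearMap
  have h : (LinearMap.range f.toLinearMap)ᗮ = ⊥ := by
    refine (Submodule.eq_bot_iff _).2 fun k hk => ?_
    -- As $W$ is the identity on $\mathcal K$, orthogonality of $k$ to $P_{\mathcal
    -- K}W(\Gamma\otimes\mathcal D_E)$ in $\mathcal K$ is orthogonality to $\Gamma\otimes\mathcal
    -- D_E$ in the dilation space. Since also $\mathcal K\perp\mathcal H_C$, this puts $k$ in
    -- $\mathcal H_A$.
    have h1 : (E.residualIncl k).snd = 0 := ext_inner_right ℂ fun x => by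
      have h2 : ⟪f x, k⟫_ℂ = 0 := hk _ ⟨x, rfl⟩
      have h3 : ⟪k, f x⟫_ℂ = 0 := inner_eq_zero_symm.1 h2
      have h4 : ⟪E.residualIncl k, HSum.inr x⟫_ℂ = 0 := by
        rw [← inner_projResidualUnitary]; exact h3
      rw [HSum.inner_eq, HSum.inr_fst, HSum.inr_snd, inner_zero_right, zero_add] at h4
      rw [h4, inner_zero_left]
    have h5 : E.residualIncl k = HSum.inl (HSum.inr (E.residualIncl k).fst.snd) :=
      HSum.ext (HSum.ext (E.residualIncl_fst_fst k) rfl) h1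
    -- $Wk=k$ lies in $\mathcal K$, so its component in $\Gamma\otimes\mathcal D_C$ is zero.
    have h6 : (E.residualIncl k).fst.snd = 0 := hE.eq_zero <| by
      rw [← h5]
      change (E.unitary _).fst.snd = 0
      rw [unitary_residual, HSum.inr_fst, WithLp.zero_snd]
    rw [h6, map_zero, map_zero] at h5
    exact E.residualIncl.injective (h5.trans (map_zero _).symm)
  exact Submodule.dense_iff_topologicalClosure_eq_top.2
    ((Submodule.topologicalClosure_eq_top_iff).2 h)

/-! ### The functional model -/

theorem norm_projResidualUnitary_sq (x : Fock ι E.DefectSpace) :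
    ‖E.projResidualUnitary (HSum.inr x)‖ ^ 2 = ‖x‖ ^ 2 - ‖E.charFun x‖ ^ 2 := by
  have h1 := HSum.norm_sq_eq (E.unitary (HSum.inr x))
  rw [LinearIsometryEquiv.norm_map, LinearIsometry.norm_map, HSum.norm_sq_eq (E.unitary _).fst,
    unitary_fst_fst_inr, norm_zero] at h1
  have h2 : E.charFun x = (E.unitary (HSum.inr x)).fst.snd := rfl
  have h3 : E.projResidualUnitary (HSum.inr x) = (E.unitary (HSum.inr x)).snd := rfl
  rw [h2, h3]
  linarith

theorem norm_charFun_le (x : Fock ι E.DefectSpace) : ‖E.charFun x‖ ≤ ‖x‖ := by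
  refine (sq_le_sq₀ (norm_nonneg _) (norm_nonneg _)).1 ?_
  linarith [E.norm_projResidualUnitary_sq x, sq_nonneg ‖E.projResidualUnitary (HSum.inr x)‖]

theorem projResidualUnitary_midOp (i : ι) (z : E.Mid) :
    E.projResidualUnitary (E.midOp i z) = E.residualOp i (E.projResidualUnitary z) := by
  change (E.unitary (E.midOp i z)).snd = E.residualOp i (E.unitary z).snd
  rw [unitary_midOp]
  simp

/-- A unitary intertwiner also intertwines the adjoints; for an isometry that is not onto this could
fail. -/
theorem adjoint_midOp_unitary (i : ι) (z : E.Mid) :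
    E.unitary (adjoint (E.midOp i) z) =
      HSum.inl (adjoint (C.midOp i) (E.unitary z).fst) +
        HSum.inr (adjoint (E.residualOp i) (E.unitary z).snd) := by
  refine ext_inner_left ℂ fun y => ?_
  obtain ⟨w, rfl⟩ := E.unitary.surjective y
  rw [LinearIsometryEquiv.inner_map_map, ContinuousLinearMap.adjoint_inner_right,
    ← LinearIsometryEquiv.inner_map_map (𝕜 := ℂ) E.unitary, unitary_midOp, HSum.inner_eq,
    HSum.inner_eq]
  simp [ContinuousLinearMap.adjoint_inner_right]

variable {E} in
theorem IsReduced.hasFunctionalModel (hE : E.IsReduced) : E.HasFunctionalModel := by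
  obtain ⟨τ, hτ⟩ := exists_linearIsometryEquiv_of_denseRange _ (delta E.charFun)
    hE.denseRange_projResidualUnitary (denseRange_toClosedRange _) fun x => by
      refine (sq_eq_sq₀ (norm_nonneg _) (norm_nonneg _)).1 ?_
      rw [norm_delta_sq E.norm_charFun_le]
      exact (E.norm_projResidualUnitary_sq x).symm
  replace hτ : ∀ x, τ (E.projResidualUnitary (HSum.inr x)) = delta E.charFun x := hτ
  -- Defining $Y_i^\Delta$ as $\tau Y_i\tau^{-1}$ makes boundedness automatic; the formula on
  -- $\Delta x$ follows from $Y_iP_{\mathcal K}Wx=P_{\mathcal K}W(L_i\otimes1)x$.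
  let Y : ι → DeltaSpace E.charFun →L[ℂ] DeltaSpace E.charFun := fun i =>
    τ.toContinuousLinearEquiv.toContinuousLinearMap ∘L E.residualOp i ∘L
      τ.symm.toContinuousLinearEquiv.toContinuousLinearMap
  have hY : ∀ i k, Y i k = τ (E.residualOp i (τ.symm k)) := fun _ _ => rfl
  have hYτ : ∀ i k, Y i (τ k) = τ (E.residualOp i k) := fun i k => by
    rw [hY, τ.symm_apply_apply]
  refine ⟨τ, Y, hτ, fun i x => ?_, fun i k => (hYτ i k).symm, ?_, fun i h => ?_⟩
  · rw [← hτ, hYτ, ← hτ, ← projResidualUnitary_midOp, RowContraction.midOp_inr]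
  -- This is $\langle Wx,Wz\rangle=\langle x,z\rangle$ written in components. Hence the image of $z$
  -- is orthogonal to all $Mx\oplus\Delta x$ exactly when $z$ has no component in
  -- $\Gamma\otimes\mathcal D_E$.
  · have key : ∀ (z : E.Mid) (x : Fock ι E.DefectSpace),
        ⟪E.charFun x, E.projFockUnitary z⟫_ℂ +
          ⟪delta E.charFun x, τ (E.projResidualUnitary z)⟫_ℂ = ⟪x, z.snd⟫_ℂ := fun z x => by
      rw [← HSum.inner_inr_left, ← LinearIsometryEquiv.inner_map_map (𝕜 := ℂ) E.unitary,
        HSum.inner_eq, HSum.inner_eq, unitary_fst_fst_inr, inner_zero_left, zero_add, ← hτ,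
        τ.inner_map_map]
      rfl
    ext y
    constructor
    · rintro ⟨a, h1, h2⟩ w hw
      induction hw using Submodule.span_induction with
      | mem w hw =>
        obtain ⟨x, hx1, hx2⟩ := hw
        rw [HSum.inner_eq, hx1, hx2, h1, h2, key, HSum.inl_snd, inner_zero_right]
      | zero => exact inner_zero_left _
      | add w w' _ _ hw hw' => rw [inner_add_left, hw, hw', add_zero]
      | smul c w _ hw => rw [inner_smul_left, hw, mul_zero]
    · intro hy
      -- Pull $y$ back with zero $\mathcal H_C$-component; `key` then kills the
      -- $\Gamma\otimes\mathcal D_E$-component, leaving a vector of $\mathcal H_A$.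
      obtain ⟨z, hz⟩ := E.unitary.surjective
        (HSum.inl (HSum.inr y.fst) + HSum.inr (τ.symm y.snd))
      have hz1 : E.projFockUnitary z = y.fst := by
        change (E.unitary z).fst.snd = _
        rw [hz]; simp
      have hz2 : τ (E.projResidualUnitary z) = y.snd := by
        change τ (E.unitary z).snd = _
        rw [hz]; simp
      have hz3 : z.fst.fst = 0 := by
        rw [← unitary_fst_fst, hz]; simp
      have hz4 : z.snd = 0 := ext_inner_left ℂ fun x => by
        rw [← key, hz1, hz2, inner_zero_right]
        have := hy (HSum.inl (E.charFun x) + HSum.inr (delta E.charFun x))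
          (Submodule.subset_span ⟨x, by simp, by simp⟩)
        rw [HSum.inner_eq] at this
        simpa using this
      have hz5 : z = HSum.inl (HSum.inr z.fst.snd) := HSum.ext (HSum.ext hz3 rfl) hz4
      exact ⟨z.fst.snd, by rw [← hz5, hz1], by rw [← hz5, hz2]⟩
  · rw [← RowContraction.adjoint_midOp_inl]
    have h1 := E.adjoint_midOp_unitary i (HSum.inl h)
    have h2 : ∀ k, adjoint (Y i) (τ k) = τ (adjoint (E.residualOp i) k) := fun k => by
      refine ext_inner_left ℂ fun w => ?_
      rw [ContinuousLinearMap.adjoint_inner_right, hY, τ.inner_map_map,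
        ← ContinuousLinearMap.adjoint_inner_right, ← τ.inner_map_map, τ.apply_symm_apply]
    constructor
    · rw [h1]; simp
    · rw [h2]
      change τ (E.unitary _).snd = τ (adjoint _ (E.unitary _).snd)
      rw [h1]; simp

/-! ### Unitary equivalence and equivalence of characteristic functions -/

theorem UnitarilyEquivalent.multiAnalyticEquivalent {E : ContractiveLifting C HA}
    {E' : ContractiveLifting C HA'} (h : E.UnitarilyEquivalent E') :
    MultiAnalyticEquivalent E.charFun E'.charFun := by
  obtain ⟨u, hu, huE⟩ := h
  have hrow : ∀ x, E'.row (L2.congr ι u x) = u (E.row x) := fun x => by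
    refine DFunLike.congr_fun
      (f := E'.row ∘L (L2.congr ι u).toContinuousLinearEquiv.toContinuousLinearMap)
      (g := u.toContinuousLinearEquiv.toContinuousLinearMap ∘L E.row)
      (L2.ext_single fun i h => ?_) x
    change E'.row (L2.congr ι u (L2.single i h)) = u (E.row (L2.single i h))
    rw [L2.congr_single, RowContraction.row_single, RowContraction.row_single, huE]
  -- $v$ sends $D_Ex$ to $D_{E'}(\bigoplus u)x$; it is isometric because
  -- $\|D_Ex\|^2=\|x\|^2-\|\underline Ex\|^2$ and $u$ intertwines the rows.
  obtain ⟨v, hv⟩ := exists_linearIsometryEquiv_of_denseRange E.defectTo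
    (E'.defectTo ∘L (L2.congr ι u).toContinuousLinearEquiv.toContinuousLinearMap)
    E.denseRange_defectTo
    (E'.denseRange_defectTo.comp (L2.congr ι u).surjective.denseRange E'.defectTo.continuous)
    fun x => by
      change ‖E'.defectTo (L2.congr ι u x)‖ = _
      rw [@norm_eq_sqrt_re_inner ℂ, @norm_eq_sqrt_re_inner ℂ, RowContraction.inner_defect,
        RowContraction.inner_defect, hrow, LinearIsometryEquiv.inner_map_map,
        LinearIsometryEquiv.inner_map_map]
  replace hv : ∀ x, v (E.defectTo x) = E'.defectTo (L2.congr ι u x) := hv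
  let U : E.Mid ≃ₗᵢ[ℂ] E'.Mid := HSum.congr u (L2.congr _ v)
  have hUl : ∀ h, U (HSum.inl h) = HSum.inl (u h) := fun h => HSum.ext (by simp [U]) (by simp [U])
  have hUr : ∀ x, U (HSum.inr x) = HSum.inr (L2.congr _ v x) := fun x =>
    HSum.ext (by simp [U]) (by simp [U])
  have hUV : ∀ i z, U (E.midOp i z) = E'.midOp i (U z) := fun i z => by
    rw [RowContraction.midOp_apply, RowContraction.midOp_apply, map_add, hUl, hUr, map_add,
      Fock.shift_congr, Fock.vac, L2.congr_single, hv, L2.congr_single, ← huE]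
    rfl
  -- The copy of $\mathcal D_C$ is generated by the vectors $V_i^Eh-C_ih$ with $h\in\mathcal H_C$,
  -- an expression that $U$ respects because it intertwines the dilations and fixes $\mathcal H_C$.
  have hUd : ∀ d, U (E.embedDefect d) = E'.embedDefect d := fun d => by
    refine C.denseRange_defectTo.induction
      (P := fun d => U (E.embedDefect d) = E'.embedDefect d) ?_ ?_ d
    · rintro _ ⟨x, rfl⟩
      rw [embedDefect_apply, embedDefect_apply]
      refine DFunLike.congr_fun
        (f := U.toContinuousLinearEquiv.toContinuousLinearMap ∘L E.preEmbed) (g := E'.preEmbed)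
        (L2.ext_single fun i h => ?_) x
      change U (E.preEmbed (L2.single i h)) = _
      rw [preEmbed_single, preEmbed_single, map_sub, hUV, hUl, hUl, hu, hu]
    · exact isClosed_eq (by fun_prop) (by fun_prop)
  have hUw : ∀ α d, U (E.embedWord α d) = E'.embedWord α d := fun α d => by
    induction α with
    | nil => exact hUd d
    | cons i α ih => exact (hUV i _).trans (congrArg _ ih)
  have hUf : ∀ f, U (E.embedFock f) = E'.embedFock f := fun f => by
    refine DFunLike.congr_fun (f := U.toContinuousLinearEquiv.toContinuousLinearMap ∘L
      E.embedFock.toContinuousLinearMap) (g := E'.embedFock.toContinuousLinearMap)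
      (L2.ext_single fun α d => ?_) f
    change U (E.embedFock (L2.single α d)) = E'.embedFock (L2.single α d)
    rw [embedFock_single, embedFock_single, hUw]
  refine ⟨v, fun d => ext_inner_left ℂ fun f => ?_⟩
  change ⟪f, E.projFockUnitary (HSum.inr (Fock.vac d))⟫_ℂ =
    ⟪f, E'.projFockUnitary (HSum.inr (Fock.vac (v d)))⟫_ℂ
  rw [← inner_embedFock, ← inner_embedFock, ← hUf, Fock.vac, Fock.vac, ← L2.congr_single, ← hUr,
    LinearIsometryEquiv.inner_map_map]

theorem IsReduced.unitarilyEquivalent {E : ContractiveLifting C HA}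
    {E' : ContractiveLifting C HA'} (hE : E.IsReduced) (hE' : E'.IsReduced)
    (h : MultiAnalyticEquivalent E.charFun E'.charFun) : E.UnitarilyEquivalent E' := by
  obtain ⟨v, hv⟩ := h
  have hM := apply_eq_apply_congr_of_symbol_eq E.charFun_shift E'.charFun_shift v hv
  set w := L2.congr (List ι) v with hw
  obtain ⟨σ, hσ⟩ := exists_linearIsometryEquiv_of_denseRange _ ((E'.projResidualUnitary ∘L
      (HSum.inr (H := HSum HC HA') (K := Fock ι E'.DefectSpace)).toContinuousLinearMap) ∘L
      w.toContinuousLinearEquiv.toContinuousLinearMap)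
    hE.denseRange_projResidualUnitary
    (hE'.denseRange_projResidualUnitary.comp w.surjective.denseRange
      (ContinuousLinearMap.continuous _)) fun x => by
      refine (sq_eq_sq₀ (norm_nonneg _) (norm_nonneg _)).1 ?_
      change ‖E'.projResidualUnitary (HSum.inr (w x))‖ ^ 2 =
        ‖E.projResidualUnitary (HSum.inr x)‖ ^ 2
      rw [norm_projResidualUnitary_sq, norm_projResidualUnitary_sq, hM, w.norm_map]
  replace hσ : ∀ x, σ (E.projResidualUnitary (HSum.inr x)) =
    E'.projResidualUnitary (HSum.inr (w x)) := hσ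
  -- On the dense set of vectors $P_{\mathcal K}Wx$ both $Y_i$ and $Y'_i$ act as the shift on $x$,
  -- and $1\otimes v$ commutes with the shift.
  have hσY : ∀ i k, σ (E.residualOp i k) = E'.residualOp i (σ k) := fun i k => by
    refine hE.denseRange_projResidualUnitary.induction
      (P := fun k => σ (E.residualOp i k) = E'.residualOp i (σ k)) ?_ ?_ k
    · rintro _ ⟨x, rfl⟩
      change σ (E.residualOp i (E.projResidualUnitary (HSum.inr x))) =
        E'.residualOp i (σ (E.projResidualUnitary (HSum.inr x)))
      rw [← projResidualUnitary_midOp, RowContraction.midOp_inr, hσ, hσ,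
        ← projResidualUnitary_midOp, RowContraction.midOp_inr, hw, Fock.shift_congr]
    · exact isClosed_eq (by fun_prop) (by fun_prop)
  let U : E.Mid ≃ₗᵢ[ℂ] E'.Mid :=
    (E.unitary.trans (HSum.congr (LinearIsometryEquiv.refl ℂ C.Mid) σ)).trans E'.unitary.symm
  have hUW : ∀ z, E'.unitary (U z) = HSum.inl (E.unitary z).fst + HSum.inr (σ (E.unitary z).snd) :=
    fun z => (E'.unitary.apply_symm_apply _).trans (HSum.ext (by simp) (by simp))
  -- After applying $W'$, the three components agree: both $\mathcal H_C$-parts vanish, the Fock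
  -- parts agree by $M=M'(1\otimes v)$, and the residual parts by the choice of $\sigma$.
  have hUr : ∀ x, U (HSum.inr x) = HSum.inr (w x) := fun x => by
    apply E'.unitary.injective
    rw [hUW]
    refine HSum.ext (HSum.ext ?_ ?_) ?_
    · simp [unitary_fst_fst]
    · simp only [WithLp.add_fst, HSum.inl_fst, HSum.inr_fst, add_zero]
      exact hM x
    · simp only [WithLp.add_snd, HSum.inl_snd, HSum.inr_snd, zero_add]
      exact hσ x
  have hUV : ∀ i z, U (E.midOp i z) = E'.midOp i (U z) := fun i z => by
    apply E'.unitary.injective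
    rw [hUW, unitary_midOp, unitary_midOp, hUW]
    refine HSum.ext (by simp) ?_
    simp [hσY]
  obtain ⟨u, hu⟩ := HSum.exists_restrict_fst U w hUr
  refine ⟨u, fun h => ?_, fun i x => ?_⟩
  · apply (HSum.inl (K := Fock ι E'.DefectSpace)).injective
    rw [← hu]
    apply E'.unitary.injective
    rw [hUW, unitary_inl_inl, unitary_inl_inl]
    exact HSum.ext (by simp) (by simp)
  -- The $\mathcal H_{E'}$-component of $UV_i^Ex=V_i^{E'}Ux$ is the required relation: the defect
  -- part of $V_i^Ex$ stays in the Fock summand under $U$ and does not contribute.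
  · have h1 := congrArg WithLp.fst (hUV i (HSum.inl x))
    rw [hu, RowContraction.midOp_fst, HSum.inl_fst, ← HSum.inl_add_inr (E.midOp i (HSum.inl x)),
      map_add, hu, hUr, RowContraction.midOp_fst] at h1
    simpa using h1.symm

end ContractiveLifting

theorem theorem4p3p7 {ι HC HA HA' : Type*} [Countable ι]
    [NormedAddCommGroup HC] [InnerProductSpace ℂ HC] [CompleteSpace HC]
    [NormedAddCommGroup HA] [InnerProductSpace ℂ HA] [CompleteSpace HA]
    [NormedAddCommGroup HA'] [InnerProductSpace ℂ HA'] [CompleteSpace HA']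
    (C : RowContraction ι HC) (E : ContractiveLifting C HA) (E' : ContractiveLifting C HA')
    (hE : E.IsReduced) (hE' : E'.IsReduced) :
    (E.UnitarilyEquivalent E' ↔ MultiAnalyticEquivalent E.charFun E'.charFun) ∧
      E.HasFunctionalModel ∧ E'.HasFunctionalModel :=
  ⟨⟨fun h => h.multiAnalyticEquivalent, fun h => hE.unitarilyEquivalent hE' h⟩,
    hE.hasFunctionalModel, hE'.hasFunctionalModel⟩
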